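/- **Theorem.** *History-deterministic co-Büchi timed automata recognise timed languages that no deterministic parity timed automaton recognises.* Conventions. An (infinite) timed word is a sequence $(a_0,t_0)(a_1,t_1)\dots$ of letters with strictly increasing timestamps $t_i\in\mathbb R_{\ge 0}$; it is *Zeno* if its timestamps are bounded. A timed automaton (TA) has finitely many states, clocks and transitions, one initial state, guards that are Boolean combinations of constraints $x-y\triangleleft n$ with $x$ a clock, $y$ a clock or the constant $0$, $n\in\mathbb N$ and $\triangleleft\in\{<,\le\}$, and is complete: for every state, clock valuation and letter some transition is enabled. Runs start in the initial state with all clocks at $0$. A TA is *deterministic* if any two distinct transitions with the same source and letter have mutually exclusive guards. A *parity* condition assigns a natural number to each transition (possibly through its source state) and accepts a run iff the largest number seen infinitely often is even; it is *co-Büchi* if only the numbers $0$ and $1$ are used. A TA is *history-deterministic* (HD) if there is a resolver that, from the finite run so far and the next timed letter (a delay and a letter), chooses an enabled transition reading that letter, in such a way that for every word in the language of the TA the run so built is accepting. All notions are understood relative to the set of timed words considered: either only the non-Zeno words, or all timed words. Let $\Sigma=\{a\}$, let $$L=\{(a,t_0)(a,t_1)\dots \mid \exists i\ \forall n\in\mathbb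 N\ \exists j\ge i:\ t_j-t_i=n\},$$ and let $Z$ be the set of all Zeno words over $\Sigma$. 1. If only non-Zeno timed words are considered, then $L$ is recognised by a history-deterministic co-Büchi TA with exactly one clock (with priorities on states), but by no deterministic parity TA. 2. If all timed words are considered, then $L\cup Z$ is recognised by a history-deterministic co-Büchi TA with exactly one clock (with priorities on states), but by no deterministic parity TA. 3. Consequently, under either convention, the class of languages of HD co-Büchi TA is not contained in the class of languages of deterministic parity TA. Over every alphabet, every language of a deterministic co-Büchi (respectively parity) TA is the language of an HD co-Büchi (respectively HD parity) TA, and over $\Sigma$ both inclusions are strict. -/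

import Mathlib

open scoped NNReal

/-! ### Timed words -/

/-- Infinite timed words over the alphabet `A`: the timestamps are non-negative, non-decreasing and
pairwise distinct, that is, strictly increasing. -/
structure TimedWord (A : Type) where
  letter : ℕ → A
  time : ℕ → ℝ≥0
  strictMono_time : StrictMono time

namespace TimedWord

variable {A : Type}

/-- The delay before the `n`-th event, so that the word reads `d₀ a₀ d₁ a₁ …`. -/
def delay (w : TimedWord A) : ℕ → ℝ≥0
  | 0 => w.time 0
  | n + 1 => w.time (n + 1) - w.time n

/-- A timed word is Zeno if it has finite duration. -/
def IsZeno (w : TimedWord A) : Prop := BddAbove (Set.range w.time)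

end TimedWord

/-- The set of Zeno words. -/
def zenoWords (A : Type) : Set (TimedWord A) := {w | w.IsZeno}

/-- The set of non-Zeno words. -/
def nonZenoWords (A : Type) : Set (TimedWord A) := {w | ¬ w.IsZeno}

/-! ### Guards -/

/-- Guards over the set `C` of clocks: Boolean combinations of the constraints `x - y < n` and
`x - y ≤ n` with `x` a clock, `y` a clock or the constant `0` (`none`), and `n` a natural number. -/
inductive Guard (C : Type) : Type where
  | tt : Guard C
  | lt (x : C) (y : Option C) (n : ℕ) : Guard C
  | le (x : C) (y : Option C) (n : ℕ) : Guard C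
  | not (g : Guard C) : Guard C
  | and (g h : Guard C) : Guard C
  | or (g h : Guard C) : Guard C

/-- The value of a member of `C ∪ {0}` under a clock valuation. -/
def clockValue {C : Type} (ν : C → ℝ≥0) : Option C → ℝ
  | none => 0
  | some y => (ν y : ℝ)

/-- `g.Sat ν`: the valuation `ν` satisfies the guard `g`. -/
def Guard.Sat {C : Type} : Guard C → (C → ℝ≥0) → Prop
  | .tt, _ => True
  | .lt x y n, ν => (ν x : ℝ) - clockValue ν y < (n : ℝ)
  | .le x y n, ν => (ν x : ℝ) - clockValue ν y ≤ (n : ℝ)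
  | .not g, ν => ¬ g.Sat ν
  | .and g h, ν => g.Sat ν ∧ h.Sat ν
  | .or g h, ν => g.Sat ν ∨ h.Sat ν

/-! ### Timed automata -/

/-- Transitions `(s, g, a, r, s')`: in state `s`, if the guard `g` holds, read the letter `a`, reset
the clocks in `r` and move to `s'`. -/
structure Transition (A Q C : Type) where
  src : Q
  guard : Guard C
  letter : A
  reset : Set C
  tgt : Q

/-- A timed automaton over the alphabet `A`, with finitely many states, clocks and transitions.
As usual it is complete: for every state, valuation and letter, some transition is enabled.
The acceptance condition is a set of infinite sequences of transitions. -/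
structure TimedAutomaton (A : Type) where
  State : Type
  Clock : Type
  finite_state : Finite State
  finite_clock : Finite Clock
  init : State
  trans : Set (Transition A State Clock)
  finite_trans : trans.Finite
  complete : ∀ (s : State) (ν : Clock → ℝ≥0) (a : A),
    ∃ τ ∈ trans, τ.src = s ∧ τ.letter = a ∧ τ.guard.Sat ν
  acc : Set (ℕ → Transition A State Clock)

open Classical in
/-- Reset the clocks in `r` to zero. -/
noncomputable def resetClocks {C : Type} (r : Set C) (ν : C → ℝ≥0) : C → ℝ≥0 :=
  fun x => if x ∈ r then 0 else ν x

/-- `maxParity c`: some priority occurs infinitely often in `c`, eventually no larger one occurs,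
and it is even. -/
def maxParity (c : ℕ → ℕ) : Prop :=
  ∃ k, Even k ∧ (∃ᶠ n in Filter.atTop, c n = k) ∧ (∀ᶠ n in Filter.atTop, c n ≤ k)

namespace TimedAutomaton

variable {A : Type} (T : TimedAutomaton A)

/-- The transitions of the automaton `T` (not necessarily members of `T.trans`). -/
abbrev Trans : Type := Transition A T.State T.Clock

/-- The clock valuation after the first `n` rounds (a delay followed by a transition) of the
sequence `ρ` of transitions taken along `w`. All clocks start at zero. -/
noncomputable def valuation (w : TimedWord A) (ρ : ℕ → T.Trans) : ℕ → T.Clock → ℝ≥0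
  | 0 => fun _ => 0
  | n + 1 => resetClocks (ρ n).reset (fun x => valuation w ρ n x + w.delay n)

/-- `ρ` is (the sequence of transitions of) a run on `w` from the initial configuration. The run is
`(s₀, ν₀) -d₀→ (s₀, ν₀ + d₀) -ρ₀→ (s₁, ν₁) -d₁→ …`. -/
structure IsRun (w : TimedWord A) (ρ : ℕ → T.Trans) : Prop where
  mem : ∀ n, ρ n ∈ T.trans
  start : (ρ 0).src = T.init
  step : ∀ n, (ρ (n + 1)).src = (ρ n).tgt
  letter : ∀ n, (ρ n).letter = w.letter n
  guard : ∀ n, (ρ n).guard.Sat (fun x => T.valuation w ρ n x + w.delay n)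

/-- `T` has an accepting run on `w`. -/
def Accepts (w : TimedWord A) : Prop := ∃ ρ, T.IsRun w ρ ∧ ρ ∈ T.acc

/-- The timed language of `T`, where `W` is the set of those timed words that are considered at all
(all timed words, or only the non-Zeno ones). -/
def language (W : Set (TimedWord A)) : Set (TimedWord A) := {w | w ∈ W ∧ T.Accepts w}

/-- Distinct transitions with the same source and letter have mutually exclusive guards. -/
def IsDeterministic : Prop :=
  ∀ τ ∈ T.trans, ∀ τ' ∈ T.trans, τ.src = τ'.src → τ.letter = τ'.letter →
    ∀ ν : T.Clock → ℝ≥0, τ.guard.Sat ν → τ'.guard.Sat ν → τ = τ'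

/-- A resolver (a strategy of Player 2 in the letter game): given a finite run from the initial
configuration, as the list of its delays and transitions, and the next timed letter, as a delay
followed by a letter, it picks a transition. -/
abbrev Resolver : Type := List (ℝ≥0 × T.Trans) → ℝ≥0 → A → T.Trans

/-- The finite run that the resolver has built after the first `n` timed letters of `w`. -/
def resolvedHistory (r : T.Resolver) (w : TimedWord A) : ℕ → List (ℝ≥0 × T.Trans)
  | 0 => []
  | n + 1 => resolvedHistory r w n ++
      [(w.delay n, r (resolvedHistory r w n) (w.delay n) (w.letter n))]

/-- The infinite sequence of transitions that the resolver takes on `w`. -/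
def resolvedRun (r : T.Resolver) (w : TimedWord A) (n : ℕ) : T.Trans :=
  r (T.resolvedHistory r w n) (w.delay n) (w.letter n)

/-- History-determinism: some resolver builds a run on every word that is considered, and this run
is accepting whenever the word is in the language. -/
def IsHistoryDeterministic (W : Set (TimedWord A)) : Prop :=
  ∃ r : T.Resolver,
    (∀ w ∈ W, T.IsRun w (T.resolvedRun r w)) ∧
    (∀ w ∈ T.language W, T.resolvedRun r w ∈ T.acc)

/-- `p` is a parity condition on transitions for the acceptance condition of `T`. -/
def AccGivenBy (p : T.Trans → ℕ) : Prop :=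
  ∀ ρ : ℕ → T.Trans, (∀ n, ρ n ∈ T.trans) → (ρ ∈ T.acc ↔ maxParity (fun n => p (ρ n)))

/-- The acceptance condition is a parity condition, with priorities on transitions. This includes
priorities on states: give a transition the priority of its source. -/
def IsParity : Prop := ∃ p : T.Trans → ℕ, T.AccGivenBy p

/-- A co-Büchi condition: a parity condition with the priorities `0` (accepting) and `1`
(rejecting), on transitions. -/
def IsCoBuchi : Prop := ∃ p : T.Trans → ℕ, (∀ τ, p τ ≤ 1) ∧ T.AccGivenBy p

/-- A co-Büchi condition with the priorities on states. -/
def IsStateCoBuchi : Prop :=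
  ∃ p : T.State → ℕ, (∀ s, p s ≤ 1) ∧ T.AccGivenBy (fun τ => p τ.src)

end TimedAutomaton

/-! ### Classes of timed languages -/

section Classes

variable {A : Type} (W : Set (TimedWord A))

/-- Languages of deterministic co-Büchi timed automata. -/
def detCoBuchiLanguages : Set (Set (TimedWord A)) :=
  {L | ∃ T : TimedAutomaton A, T.IsDeterministic ∧ T.IsCoBuchi ∧ T.language W = L}

/-- Languages of deterministic parity timed automata. -/
def detParityLanguages : Set (Set (TimedWord A)) :=
  {L | ∃ T : TimedAutomaton A, T.IsDeterministic ∧ T.IsParity ∧ T.language W = L}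

/-- Languages of history-deterministic co-Büchi timed automata. -/
def hdCoBuchiLanguages : Set (Set (TimedWord A)) :=
  {L | ∃ T : TimedAutomaton A, T.IsHistoryDeterministic W ∧ T.IsCoBuchi ∧ T.language W = L}

/-- Languages of history-deterministic parity timed automata. -/
def hdParityLanguages : Set (Set (TimedWord A)) :=
  {L | ∃ T : TimedAutomaton A, T.IsHistoryDeterministic W ∧ T.IsParity ∧ T.language W = L}

end Classes

/-- The witness language over a singleton alphabet: there is an event at some time `t` such that
there is an event at time `t + n` for every natural number `n`. -/
def unitDistanceLanguage : Set (TimedWord Unit) :=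
  {w | ∃ i : ℕ, ∀ n : ℕ, ∃ j ≥ i, (w.time j : ℝ) - (w.time i : ℝ) = n}

/-! ### Timed words and the co-Büchi condition -/

/-! Call the events at times `t m + k`, for natural `k`, the chain of event `m`.

Upper bound: `chainAutomaton` guesses an event and uses its clock to follow the chain of that event.
More than one time unit separates consecutive rejections, so every run on a Zeno word is accepting
(`mem_acc_of_isZeno`); on a non-Zeno word, a run that stops rejecting follows a complete chain
(`mem_unitDistanceLanguage`). The resolver guesses an event exactly when it lies on the oldest chain
not yet broken. If the word has a complete chain, let `m` be the first event that starts one. All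
older chains break eventually, and from then on the chain of `m` is the oldest. A later rejection is
followed within one unit by an event on it, which is picked and never lost, so rejections stop
(`mem_acc_of_mem_unitDistanceLanguage`).

Lower bound: given a deterministic automaton, take `B` at least the number of its unit states and
put `2 * B + 1` events in each time unit. Non-middle events close in on the middle from unit to
unit, so a non-middle event of the past lies on one fixed side of all fractional parts of the
current unit, and guards cannot locate the middle event. By pigeonhole the behaviour repeats within
the first `B + 1` events of the unit, so the transition at the middle event is taken again later in
that unit. Hence no clock carries the time of a middle event into another unit
(`not_isMiddle_lastReset`). The run on the word whose middle events are at distance one is then also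
a run on the word whose middle events are perturbed (`isRun_middleWord_true`). Acceptance depends
only on the transitions, yet only the first word is in the language. -/

theorem TimedWord.time_add_delay {A : Type} (w : TimedWord A) (n : ℕ) :
    w.time n + w.delay (n + 1) = w.time (n + 1) :=
  add_tsub_cancel_of_le (w.strictMono_time.monotone n.le_succ)

theorem unitDistanceLanguage_subset_nonZenoWords :
    unitDistanceLanguage ⊆ nonZenoWords Unit := by
  rintro w ⟨i, hi⟩ ⟨b, hb⟩
  obtain ⟨n, hn⟩ := exists_nat_gt b
  obtain ⟨j, -, hj⟩ := hi n
  have h1 : w.time j ≤ b := hb ⟨j, rfl⟩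
  have h2 : (w.time j : ℝ) ≤ b := by exact_mod_cast h1
  have h3 : (b : ℝ) < n := by exact_mod_cast hn
  have h4 := (w.time i).coe_nonneg
  linarith

/-- With priorities at most `1`, the parity condition says that `1` occurs finitely often. -/
theorem maxParity_iff_eventually_eq_zero {c : ℕ → ℕ} (hc : ∀ n, c n ≤ 1) :
    maxParity c ↔ ∀ᶠ n in Filter.atTop, c n = 0 := by
  constructor
  · rintro ⟨k, hk, hf, he⟩
    obtain ⟨n, hn⟩ := hf.exists
    have h0 : k = 0 := by
      have := hc n
      obtain ⟨m, rfl⟩ := hk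
      omega
    filter_upwards [he] with n hn
    omega
  · intro h
    exact ⟨0, Even.zero, h.frequently, h.mono fun n hn => hn.le⟩

theorem resetClocks_empty {C : Type} (ν : C → ℝ≥0) : resetClocks ∅ ν = ν :=
  funext fun _ => if_neg fun h => h

theorem resetClocks_univ {C : Type} (ν : C → ℝ≥0) : resetClocks Set.univ ν = fun _ => 0 :=
  funext fun x => if_pos (Set.mem_univ x)

namespace TimedAutomaton

variable {A : Type} (T : TimedAutomaton A)

/-! ### Building resolvers -/

/-- The state reached by a finite run. -/
def historyState (h : List (ℝ≥0 × T.Trans)) : T.State :=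
  (h.getLast?.map fun e => e.2.tgt).getD T.init

/-- The clock valuation reached by a finite run. -/
noncomputable def historyValuation (h : List (ℝ≥0 × T.Trans)) : T.Clock → ℝ≥0 :=
  h.foldl (fun ν e => resetClocks e.2.reset fun x => ν x + e.1) fun _ => 0

theorem historyState_resolvedHistory_succ (r : T.Resolver) (w : TimedWord A) (n : ℕ) :
    T.historyState (T.resolvedHistory r w (n + 1)) = (T.resolvedRun r w n).tgt := by
  simp [historyState, resolvedHistory, resolvedRun]

/-- A resolver sees only a finite list, whereas runs are defined from the infinite word; this makes
the two computations of clock values agree. -/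
theorem historyValuation_resolvedHistory (r : T.Resolver) (w : TimedWord A) (n : ℕ) :
    T.historyValuation (T.resolvedHistory r w n) = T.valuation w (T.resolvedRun r w) n := by
  induction n with
  | zero => rfl
  | succ n ih =>
    simp only [historyValuation] at ih
    simp only [historyValuation, resolvedHistory, valuation, List.foldl_append, List.foldl_cons,
      List.foldl_nil, ih, resolvedRun]

/-- `τ` can be taken after the finite run `h`, the delay `d` and the letter `a`. -/
structure IsEnabled (h : List (ℝ≥0 × T.Trans)) (d : ℝ≥0) (a : A) (τ : T.Trans) : Prop where
  mem : τ ∈ T.trans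
  src : τ.src = T.historyState h
  letter : τ.letter = a
  guard : τ.guard.Sat fun x => T.historyValuation h x + d

theorem exists_isEnabled (h : List (ℝ≥0 × T.Trans)) (d : ℝ≥0) (a : A) :
    ∃ τ, T.IsEnabled h d a τ := by
  obtain ⟨τ, h1, h2, h3, h4⟩ :=
    T.complete (T.historyState h) (fun x => T.historyValuation h x + d) a
  exact ⟨τ, h1, h2, h3, h4⟩

variable {T}

theorem isRun_resolvedRun {r : T.Resolver} (hr : ∀ h d a, T.IsEnabled h d a (r h d a))
    (w : TimedWord A) : T.IsRun w (T.resolvedRun r w) where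
  mem n := (hr _ _ _).mem
  start := (hr _ _ _).src
  step n := ((hr _ _ _).src).trans (T.historyState_resolvedHistory_succ r w n)
  letter n := (hr _ _ _).letter
  guard n := by
    have := (hr (T.resolvedHistory r w n) (w.delay n) (w.letter n)).guard
    rwa [historyValuation_resolvedHistory] at this

theorem valuation_congr {w : TimedWord A} {ρ ρ' : ℕ → T.Trans} {n : ℕ}
    (h : ∀ m < n, ρ m = ρ' m) : T.valuation w ρ n = T.valuation w ρ' n := by
  induction n with
  | zero => rfl
  | succ n ih =>
    simp only [valuation, h n n.lt_succ_self, ih fun m hm => h m (hm.trans n.lt_succ_self)]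

theorem IsDeterministic.run_unique (hT : T.IsDeterministic) {w : TimedWord A}
    {ρ ρ' : ℕ → T.Trans} (h : T.IsRun w ρ) (h' : T.IsRun w ρ') : ρ = ρ' := by
  funext n
  induction n using Nat.strong_induction_on with
  | _ n ih =>
    have hsrc : (ρ n).src = (ρ' n).src := by
      cases n with
      | zero => rw [h.start, h'.start]
      | succ n => rw [h.step, h'.step, ih n n.lt_succ_self]
    have hg := h'.guard n
    rw [← valuation_congr ih] at hg
    exact hT _ (h.mem n) _ (h'.mem n) hsrc ((h.letter n).trans (h'.letter n).symm) _
      (h.guard n) hg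

/-- Every deterministic timed automaton is history-deterministic. -/
theorem IsDeterministic.isHistoryDeterministic (hT : T.IsDeterministic) (W : Set (TimedWord A)) :
    T.IsHistoryDeterministic W := by
  choose r hr using T.exists_isEnabled
  refine ⟨r, fun w _ => isRun_resolvedRun hr w, ?_⟩
  rintro w ⟨-, ρ, hρ, hacc⟩
  rwa [hT.run_unique (isRun_resolvedRun hr w) hρ]

theorem IsHistoryDeterministic.mono {V W : Set (TimedWord A)} (hVW : V ⊆ W)
    (hT : T.IsHistoryDeterministic W) : T.IsHistoryDeterministic V := by
  obtain ⟨r, h1, h2⟩ := hT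
  exact ⟨r, fun w hw => h1 w (hVW hw), fun w hw => h2 w ⟨hVW hw.1, hw.2⟩⟩

theorem IsCoBuchi.isParity (hT : T.IsCoBuchi) : T.IsParity := by
  obtain ⟨p, -, hp⟩ := hT
  exact ⟨p, hp⟩

theorem IsStateCoBuchi.isCoBuchi (hT : T.IsStateCoBuchi) : T.IsCoBuchi := by
  obtain ⟨p, h1, hp⟩ := hT
  exact ⟨fun τ => p τ.src, fun τ => h1 _, hp⟩

end TimedAutomaton

/-! ### Inclusions between the classes of languages -/

theorem detCoBuchiLanguages_subset_hdCoBuchiLanguages {A : Type} (W : Set (TimedWord A)) :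
    detCoBuchiLanguages W ⊆ hdCoBuchiLanguages W := by
  rintro L ⟨T, h1, h2, h3⟩
  exact ⟨T, h1.isHistoryDeterministic W, h2, h3⟩

theorem detParityLanguages_subset_hdParityLanguages {A : Type} (W : Set (TimedWord A)) :
    detParityLanguages W ⊆ hdParityLanguages W := by
  rintro L ⟨T, h1, h2, h3⟩
  exact ⟨T, h1.isHistoryDeterministic W, h2, h3⟩

theorem detCoBuchiLanguages_subset_detParityLanguages {A : Type} (W : Set (TimedWord A)) :
    detCoBuchiLanguages W ⊆ detParityLanguages W := by
  rintro L ⟨T, h1, h2, h3⟩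
  exact ⟨T, h1, h2.isParity, h3⟩

theorem hdCoBuchiLanguages_subset_hdParityLanguages {A : Type} (W : Set (TimedWord A)) :
    hdCoBuchiLanguages W ⊆ hdParityLanguages W := by
  rintro L ⟨T, h1, h2, h3⟩
  exact ⟨T, h1, h2.isParity, h3⟩

/-! ### A history-deterministic co-Büchi automaton for the witness language -/

/-- The states of the automaton `chainAutomaton`: it looks for a chain of events at distance one
(`searching`), it follows such a chain (`tracking`), or its last attempt has just failed
(`rejecting`). -/
inductive Phase : Type where
  | rejecting
  | searching
  | tracking

namespace Phase

instance : Finite Phase :=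
  Finite.of_injective (fun p : Phase => match p with
    | rejecting => (0 : Fin 3)
    | searching => 1
    | tracking => 2) (by rintro (_ | _ | _) (_ | _ | _) h <;> simp_all)

/-- The priorities of the states. -/
def priority : Phase → ℕ
  | rejecting => 1
  | searching => 0
  | tracking => 0

theorem priority_eq_zero_iff (p : Phase) : p.priority = 0 ↔ p ≠ rejecting := by
  cases p <;> simp [priority]

theorem priority_le_one (p : Phase) : p.priority ≤ 1 := by
  cases p <;> simp [priority]

end Phase

namespace chainAutomaton

open Phase

/-- The clock is at most `1`. -/
def early : Guard Unit := .le () none 1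

/-- Keep searching for a chain. -/
def wait (p : Phase) : Transition Unit Phase Unit := ⟨p, early, (), ∅, searching⟩

/-- Start to follow the chain of the current event. -/
def pick (p : Phase) : Transition Unit Phase Unit := ⟨p, early, (), Set.univ, tracking⟩

/-- Skip an event that is not on the chain. -/
def skip : Transition Unit Phase Unit := ⟨tracking, .lt () none 1, (), ∅, tracking⟩

/-- Read an event that is on the chain. -/
def hit : Transition Unit Phase Unit :=
  ⟨tracking, .and early (.not (.lt () none 1)), (), Set.univ, tracking⟩

/-- The deadline is missed. -/
def fail (p : Phase) : Transition Unit Phase Unit := ⟨p, .not early, (), Set.univ, rejecting⟩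

/-- All transitions. -/
def transitions : Set (Transition Unit Phase Unit) :=
  {wait rejecting, wait searching, pick rejecting, pick searching, skip, hit,
    fail rejecting, fail searching, fail tracking}

theorem early_sat {ν : Unit → ℝ≥0} : early.Sat ν ↔ ν () ≤ 1 := by
  simp [early, Guard.Sat, clockValue]

theorem lt_one_sat {ν : Unit → ℝ≥0} : (Guard.lt () none 1).Sat ν ↔ ν () < 1 := by
  simp [Guard.Sat, clockValue]

/-- Whether a chain is picked can be decided freely. -/
theorem exists_transition (p : Phase) (ν : Unit → ℝ≥0) (b : Prop) :
    ∃ τ ∈ transitions, τ.src = p ∧ τ.guard.Sat ν ∧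
      (p ≠ tracking → ν () ≤ 1 → (τ.tgt = tracking ↔ b)) := by
  by_cases h : ν () ≤ 1
  · have hp : p = tracking ∨ p = rejecting ∨ p = searching := by cases p <;> simp
    by_cases hb : b
    · rcases hp with rfl | hp
      · by_cases h' : ν () < 1
        · exact ⟨skip, by simp [transitions], rfl, lt_one_sat.2 h', by simp⟩
        · exact ⟨hit, by simp [transitions], rfl, ⟨early_sat.2 h, mt lt_one_sat.1 h'⟩, by simp⟩
      · refine ⟨pick p, ?_, rfl, early_sat.2 h, by simp [pick, hb]⟩
        rcases hp with rfl | rfl <;> simp [transitions]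
    · rcases hp with rfl | hp
      · by_cases h' : ν () < 1
        · exact ⟨skip, by simp [transitions], rfl, lt_one_sat.2 h', by simp⟩
        · exact ⟨hit, by simp [transitions], rfl, ⟨early_sat.2 h, mt lt_one_sat.1 h'⟩, by simp⟩
      · refine ⟨wait p, ?_, rfl, early_sat.2 h, by simp [wait, hb]⟩
        rcases hp with rfl | rfl <;> simp [transitions]
  · exact ⟨fail p, by cases p <;> simp [transitions], rfl, mt early_sat.1 h, fun _ h' => absurd h' h⟩

theorem cases_of_sat {τ : Transition Unit Phase Unit} (hτ : τ ∈ transitions) {ν : Unit → ℝ≥0}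
    (hν : τ.guard.Sat ν) :
    (ν () ≤ 1 ∧ τ.src ≠ tracking ∧ τ.tgt = searching ∧ τ.reset = ∅) ∨
    (ν () ≤ 1 ∧ τ.src ≠ tracking ∧ τ.tgt = tracking ∧ τ.reset = Set.univ) ∨
    (ν () < 1 ∧ τ.src = tracking ∧ τ.tgt = tracking ∧ τ.reset = ∅) ∨
    (ν () = 1 ∧ τ.src = tracking ∧ τ.tgt = tracking ∧ τ.reset = Set.univ) ∨
    (1 < ν () ∧ τ.tgt = rejecting ∧ τ.reset = Set.univ) := by
  rcases hτ with rfl | rfl | rfl | rfl | rfl | rfl | rfl | rfl | rfl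
  · exact .inl ⟨early_sat.1 hν, by simp [wait], rfl, rfl⟩
  · exact .inl ⟨early_sat.1 hν, by simp [wait], rfl, rfl⟩
  · exact .inr <| .inl ⟨early_sat.1 hν, by simp [pick], rfl, rfl⟩
  · exact .inr <| .inl ⟨early_sat.1 hν, by simp [pick], rfl, rfl⟩
  · exact .inr <| .inr <| .inl ⟨lt_one_sat.1 hν, rfl, rfl, rfl⟩
  · exact .inr <| .inr <| .inr <| .inl
      ⟨le_antisymm (early_sat.1 hν.1) (not_lt.1 fun h => hν.2 (lt_one_sat.2 h)), rfl, rfl, rfl⟩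
  all_goals
    exact .inr <| .inr <| .inr <| .inr ⟨not_le.1 fun h => hν (early_sat.2 h), rfl, rfl⟩

end chainAutomaton

open chainAutomaton in
/-- The automaton guesses an event, and then checks that there is an event exactly one time unit
after the last event that it has followed. If this fails, or if it does not guess within one time
unit after a failure, it visits the rejecting state. -/
def chainAutomaton : TimedAutomaton Unit where
  State := Phase
  Clock := Unit
  finite_state := inferInstance
  finite_clock := inferInstance
  init := .rejecting
  trans := transitions
  finite_trans := by
    unfold transitions
    exact Set.toFinite _
  complete s ν a := by
    obtain ⟨τ, h1, h2, h3, -⟩ := exists_transition s ν True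
    exact ⟨τ, h1, h2, rfl, h3⟩
  acc := {ρ | maxParity fun n => (ρ n).src.priority}

namespace chainAutomaton

open Phase

theorem isStateCoBuchi : chainAutomaton.IsStateCoBuchi :=
  ⟨Phase.priority, Phase.priority_le_one, fun _ _ => Iff.rfl⟩

theorem mem_acc_iff {ρ : ℕ → chainAutomaton.Trans} :
    ρ ∈ chainAutomaton.acc ↔ ∃ M, ∀ n ≥ M, (ρ n).src ≠ rejecting := by
  refine (maxParity_iff_eventually_eq_zero fun n => Phase.priority_le_one _).trans ?_
  rw [Filter.eventually_atTop]
  exact exists_congr fun M => forall₂_congr fun n _ => Phase.priority_eq_zero_iff _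

/-! ### Clock behaviour and soundness of the chain automaton -/

variable {w : TimedWord Unit} {ρ : ℕ → chainAutomaton.Trans}

/-- The value of the clock before the delay `w.delay n`. -/
noncomputable def clock (w : TimedWord Unit) (ρ : ℕ → chainAutomaton.Trans) (n : ℕ) : ℝ≥0 :=
  chainAutomaton.valuation w ρ n ()

/-- The five cases are `wait`, `pick`, `skip`, `hit` and `fail`, in this order; the later arguments
about runs use only this case split. -/
theorem run_cases (h : chainAutomaton.IsRun w ρ) (n : ℕ) :
    (clock w ρ n + w.delay n ≤ 1 ∧ (ρ n).src ≠ tracking ∧ (ρ (n + 1)).src = searching ∧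
      clock w ρ (n + 1) = clock w ρ n + w.delay n) ∨
    (clock w ρ n + w.delay n ≤ 1 ∧ (ρ n).src ≠ tracking ∧ (ρ (n + 1)).src = tracking ∧
      clock w ρ (n + 1) = 0) ∨
    (clock w ρ n + w.delay n < 1 ∧ (ρ n).src = tracking ∧ (ρ (n + 1)).src = tracking ∧
      clock w ρ (n + 1) = clock w ρ n + w.delay n) ∨
    (clock w ρ n + w.delay n = 1 ∧ (ρ n).src = tracking ∧ (ρ (n + 1)).src = tracking ∧
      clock w ρ (n + 1) = 0) ∨
    (1 < clock w ρ n + w.delay n ∧ (ρ (n + 1)).src = rejecting ∧ clock w ρ (n + 1) = 0) := by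
  have hr0 : (ρ n).reset = ∅ → clock w ρ (n + 1) = clock w ρ n + w.delay n := fun hr => by
    rw [clock, TimedAutomaton.valuation, hr, resetClocks_empty, clock]
  have hr1 : (ρ n).reset = Set.univ → clock w ρ (n + 1) = 0 := fun hr => by
    rw [clock, TimedAutomaton.valuation, hr, resetClocks_univ]
  rw [h.step n]
  rcases cases_of_sat (h.mem n) (h.guard n) with h | h | h | h | h
  · exact .inl ⟨h.1, h.2.1, h.2.2.1, hr0 h.2.2.2⟩
  · exact .inr <| .inl ⟨h.1, h.2.1, h.2.2.1, hr1 h.2.2.2⟩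
  · exact .inr <| .inr <| .inl ⟨h.1, h.2.1, h.2.2.1, hr0 h.2.2.2⟩
  · exact .inr <| .inr <| .inr <| .inl ⟨h.1, h.2.1, h.2.2.1, hr1 h.2.2.2⟩
  · exact .inr <| .inr <| .inr <| .inr ⟨h.1, h.2.1, hr1 h.2.2⟩

theorem clock_succ_le (h : chainAutomaton.IsRun w ρ) (n : ℕ) :
    clock w ρ (n + 1) ≤ clock w ρ n + w.delay n := by
  rcases run_cases h n with h | h | h | h | h
  · exact h.2.2.2.le
  · simp [h.2.2.2]
  · exact h.2.2.2.le
  · simp [h.2.2.2]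
  · simp [h.2.2]

/-- The clock value after an event bounds its value after the later events. -/
theorem clock_add_time_le (h : chainAutomaton.IsRun w ρ) {i j : ℕ} (hij : i ≤ j) :
    clock w ρ (j + 1) + w.time i ≤ clock w ρ (i + 1) + w.time j := by
  induction j, hij using Nat.le_induction with
  | base => exact le_rfl
  | succ j _ ih =>
    rw [← w.time_add_delay]
    calc _ ≤ clock w ρ (j + 1) + w.delay (j + 1) + w.time i := by gcongr; exact clock_succ_le h _
      _ = clock w ρ (j + 1) + w.time i + w.delay (j + 1) := by ring
      _ ≤ clock w ρ (i + 1) + w.time j + w.delay (j + 1) := by gcongr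
      _ = _ := by ring

/-- As long as there is no reset, the clock measures the elapsed time. -/
theorem clock_add_time_eq (h : chainAutomaton.IsRun w ρ) {i j : ℕ} (hij : i ≤ j)
    (hr : ∀ m, i < m → m ≤ j → clock w ρ (m + 1) ≠ 0) :
    clock w ρ (j + 1) + w.time i = clock w ρ (i + 1) + w.time j := by
  induction j, hij using Nat.le_induction with
  | base => rfl
  | succ j hj ih =>
    have hs : clock w ρ (j + 1 + 1) = clock w ρ (j + 1) + w.delay (j + 1) := by
      have h0 := hr (j + 1) (by omega) le_rfl
      rcases run_cases h (j + 1) with h | h | h | h | h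
      · exact h.2.2.2
      · exact absurd h.2.2.2 h0
      · exact h.2.2.2
      · exact absurd h.2.2.2 h0
      · exact absurd h.2.2 h0
    rw [← w.time_add_delay, hs, add_right_comm, ih fun m h1 h2 => hr m h1 (by omega)]
    ring

/-- Every run on a Zeno word is accepting. -/
theorem mem_acc_of_isZeno (h : chainAutomaton.IsRun w ρ) (hw : w.IsZeno) :
    ρ ∈ chainAutomaton.acc := by
  rw [mem_acc_iff]
  by_contra! hM
  -- Infinitely many rejections would push time past every integer: each one resets the clock, and
  -- the next needs the clock to exceed `1`.
  have hstep : ∀ c : ℕ, ∃ n, (c : ℝ≥0) ≤ w.time n := by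
    intro c
    induction c with
    | zero => exact ⟨0, by simp⟩
    | succ c ih =>
      obtain ⟨n, hn⟩ := ih
      have key : ∀ m ≥ n, ∃ i > m, (ρ i).src = rejecting ∧ clock w ρ i = 0 ∧
          1 < clock w ρ (i - 1) + w.delay (i - 1) := by
        intro m _
        obtain ⟨i, hi, hrej⟩ := hM (m + 1)
        obtain ⟨i, rfl⟩ := Nat.exists_eq_succ_of_ne_zero (show i ≠ 0 by omega)
        refine ⟨i + 1, by omega, hrej, ?_⟩
        rcases run_cases h i with h | h | h | h | h <;> simp_all
      obtain ⟨i, hi, -, hi0, -⟩ := key n le_rfl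
      obtain ⟨j, hj, -, -, hj1⟩ := key (i + 1) (by omega)
      refine ⟨j - 1, ?_⟩
      obtain ⟨i, rfl⟩ := Nat.exists_eq_succ_of_ne_zero (show i ≠ 0 by omega)
      obtain ⟨j, rfl⟩ := Nat.exists_eq_succ_of_ne_zero (show j ≠ 0 by omega)
      obtain ⟨j, rfl⟩ := Nat.exists_eq_succ_of_ne_zero (show j ≠ 0 by omega)
      simp only [Nat.succ_eq_add_one, Nat.add_sub_cancel] at *
      have h1 := clock_add_time_le h (show i ≤ j by omega)
      have h2 := w.time_add_delay j
      have h3 := w.strictMono_time.monotone (show n ≤ i by omega)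
      rw [hi0, zero_add] at h1
      push_cast
      calc (c : ℝ≥0) + 1 ≤ w.time i + (clock w ρ (j + 1) + w.delay (j + 1)) :=
            add_le_add (hn.trans h3) hj1.le
        _ = clock w ρ (j + 1) + w.time i + w.delay (j + 1) := by ring
        _ ≤ w.time j + w.delay (j + 1) := by gcongr
        _ = _ := h2
  obtain ⟨b, hb⟩ := hw
  obtain ⟨c, hc⟩ := exists_nat_gt b
  obtain ⟨n, hn⟩ := hstep c
  exact absurd (hc.trans_le hn) (not_lt.2 (hb ⟨n, rfl⟩))

/-- The language of the automaton consists of Zeno words and words of the witness language. -/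
theorem mem_unitDistanceLanguage (h : chainAutomaton.IsRun w ρ) (hw : ¬ w.IsZeno)
    (hacc : ρ ∈ chainAutomaton.acc) : w ∈ unitDistanceLanguage := by
  obtain ⟨M, hM⟩ := mem_acc_iff.1 hacc
  have hle : ∀ n ≥ M, clock w ρ n + w.delay n ≤ 1 := by
    intro n hn
    have := hM (n + 1) (by omega)
    rcases run_cases h n with h | h | h | h | h
    · exact h.1
    · exact h.1
    · exact h.1.le
    · exact h.1.le
    · exact absurd h.2.1 this
  -- Without further resets the clock would measure elapsed time while staying at most `1`, so the
  -- word would be Zeno.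
  have hreset : ∀ i ≥ M, ∃ j > i, clock w ρ (j + 1) = 0 := by
    intro i hi
    by_contra! hcon
    refine hw ⟨1 + w.time i, ?_⟩
    rintro _ ⟨n, rfl⟩
    rcases le_total n i with hn | hn
    · exact (w.strictMono_time.monotone hn).trans le_add_self
    · have h1 := clock_add_time_eq h hn fun m hm _ => hcon m hm
      have h2 := (clock_succ_le h n).trans (hle n (hi.trans hn))
      calc w.time n ≤ clock w ρ (i + 1) + w.time n := le_add_self
        _ = clock w ρ (n + 1) + w.time i := h1.symm
        _ ≤ _ := by gcongr
  obtain ⟨i, hi, hi0⟩ := hreset M le_rfl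
  -- Without rejection, a reset after `M` leads to `tracking`, and only `fail` leaves that state.
  have htrack : ∀ n ≥ i, (ρ (n + 1)).src = tracking := by
    intro n hn
    induction n, hn using Nat.le_induction with
    | base =>
      have := hM (i + 1) (by omega)
      rcases run_cases h i with h | h | h | h | h
      -- Waiting does not reset, so a zero clock would force a zero delay. Only the very first delay
      -- can be zero, and `i > M` excludes it.
      · obtain ⟨i, rfl⟩ := Nat.exists_eq_succ_of_ne_zero (show i ≠ 0 by omega)
        have h1 : w.delay (i + 1) = 0 := by
          have := h.2.2.2
          rw [hi0] at this
          exact (add_eq_zero.1 this.symm).2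
        have h2 := w.time_add_delay i
        rw [h1, add_zero] at h2
        exact absurd h2 (w.strictMono_time i.lt_succ_self).ne
      · exact h.2.2.1
      · exact h.2.2.1
      · exact h.2.2.1
      · exact absurd h.2.1 this
    | succ n hn ih =>
      have := hM (n + 1 + 1) (by omega)
      rcases run_cases h (n + 1) with h | h | h | h | h
      · exact absurd ih h.2.1
      · exact h.2.2.1
      · exact h.2.2.1
      · exact h.2.2.1
      · exact absurd h.2.1 this
  have hchain : ∀ k : ℕ, ∃ j ≥ i, clock w ρ (j + 1) = 0 ∧ w.time j = w.time i + k := by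
    intro k
    induction k with
    | zero => exact ⟨i, le_rfl, hi0, by simp⟩
    | succ k ih =>
      obtain ⟨j, hj, hj0, hjk⟩ := ih
      classical
      -- The first reset after `j` is the next link: in `tracking`, it can only be a `hit`, at clock
      -- value exactly `1`.
      have hex := hreset j (by omega)
      obtain ⟨hn, hn0⟩ := Nat.find_spec hex
      have hmin := fun m (hm : m < Nat.find hex) => Nat.find_min hex hm
      generalize Nat.find hex = n at hn hn0 hmin
      refine ⟨n, by omega, hn0, ?_⟩
      obtain ⟨n, rfl⟩ := Nat.exists_eq_succ_of_ne_zero (show n ≠ 0 by omega)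
      have h1 := clock_add_time_eq h (show j ≤ n by omega) fun m hm hm' h0 =>
        hmin m (by omega) ⟨hm, h0⟩
      have hd : w.delay (n + 1) ≠ 0 := fun h0 => by
        have h2 := w.time_add_delay n
        rw [h0, add_zero] at h2
        exact absurd h2 (w.strictMono_time n.lt_succ_self).ne
      have hx : clock w ρ (n + 1) + w.delay (n + 1) = 1 := by
        have h3 := htrack n (by omega)
        have h4 := hM (n + 1 + 1) (by omega)
        rcases run_cases h (n + 1) with h | h | h | h | h
        · exact absurd h3 h.2.1
        · exact absurd h3 h.2.1
        · have := h.2.2.2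
          rw [Nat.succ_eq_add_one] at hn0
          rw [hn0] at this
          exact absurd (add_eq_zero.1 this.symm).2 hd
        · exact h.1
        · exact absurd h.2.1 h4
      rw [hj0, zero_add] at h1
      have h2 := w.time_add_delay n
      rw [Nat.succ_eq_add_one, ← h2, ← h1, add_right_comm, hx, hjk]
      push_cast
      ring
  refine ⟨i, fun k => ?_⟩
  obtain ⟨j, hj, -, hjk⟩ := hchain k
  refine ⟨j, hj, ?_⟩
  rw [hjk]
  simp

/-! ### The resolver -/

/-- At time `t n`, no event has been missed on the chain that starts with event `m`. -/
def AliveAt (t : ℕ → ℝ≥0) (n m : ℕ) : Prop :=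
  m ≤ n ∧ ∀ k : ℕ, t m + k ≤ t n → ∃ j ≤ n, t j = t m + k

/-- Event `n` lies on the oldest chain on which no event has been missed. -/
def OnOldestChain (t : ℕ → ℝ≥0) (n : ℕ) : Prop :=
  ∃ m, AliveAt t n m ∧ (∀ m' < m, ¬ AliveAt t n m') ∧ ∃ k : ℕ, t n = t m + k

theorem AliveAt.congr {t t' : ℕ → ℝ≥0} {n m : ℕ} (h : ∀ i ≤ n, t i = t' i)
    (hm : AliveAt t n m) : AliveAt t' n m := by
  refine ⟨hm.1, fun k hk => ?_⟩
  rw [← h m hm.1, ← h n le_rfl] at hk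
  obtain ⟨j, hj, hjk⟩ := hm.2 k hk
  exact ⟨j, hj, by rw [← h j hj, hjk, h m hm.1]⟩

theorem OnOldestChain.congr {t t' : ℕ → ℝ≥0} {n : ℕ} (h : ∀ i ≤ n, t i = t' i)
    (hn : OnOldestChain t n) : OnOldestChain t' n := by
  obtain ⟨m, h1, h2, k, hk⟩ := hn
  exact ⟨m, h1.congr h, fun m' hm' h' => h2 m' hm' (h'.congr fun i hi => (h i hi).symm), k,
    by rw [← h n le_rfl, ← h m h1.1, hk]⟩

/-- The timestamps that belong to a list of delays. -/
def timestamps (l : List ℝ≥0) (i : ℕ) : ℝ≥0 := (l.take (i + 1)).sum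

theorem sum_delay (w : TimedWord Unit) (n : ℕ) :
    ((List.range (n + 1)).map w.delay).sum = w.time n := by
  induction n with
  | zero => simp [TimedWord.delay]
  | succ n ih => rw [List.range_succ, List.map_append, List.sum_append, ih]; simp [w.time_add_delay]

theorem timestamps_range (w : TimedWord Unit) {n i : ℕ} (h : i ≤ n) :
    timestamps ((List.range (n + 1)).map w.delay) i = w.time i := by
  rw [timestamps, ← List.map_take, List.take_range, min_eq_left (by omega), sum_delay]

theorem resolvedHistory_map_fst (r : chainAutomaton.Resolver) (w : TimedWord Unit) (n : ℕ) :
    (chainAutomaton.resolvedHistory r w n).map Prod.fst = (List.range n).map w.delay := by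
  induction n with
  | zero => rfl
  | succ n ih => simp [TimedAutomaton.resolvedHistory, ih, List.range_succ]

/-- A resolver can pick a chain exactly when the current event is on the oldest chain. -/
theorem exists_resolver : ∃ r : chainAutomaton.Resolver,
    ∀ w, chainAutomaton.IsRun w (chainAutomaton.resolvedRun r w) ∧
      ∀ n, (chainAutomaton.resolvedRun r w n).src ≠ tracking →
        clock w (chainAutomaton.resolvedRun r w) n + w.delay n ≤ 1 →
        ((chainAutomaton.resolvedRun r w (n + 1)).src = tracking ↔ OnOldestChain w.time n) := by
  -- Being on the oldest chain depends only on the timestamps so far, which are the partial sums of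
  -- the delays in the history.
  have key : ∀ (h : List (ℝ≥0 × chainAutomaton.Trans)) (d : ℝ≥0) (a : Unit),
      ∃ τ, chainAutomaton.IsEnabled h d a τ ∧
        (τ.src ≠ tracking → chainAutomaton.historyValuation h () + d ≤ 1 →
          (τ.tgt = tracking ↔ OnOldestChain (timestamps (h.map Prod.fst ++ [d])) h.length)) := by
    intro h d a
    obtain ⟨τ, h1, h2, h3, h4⟩ := exists_transition (chainAutomaton.historyState h)
      (fun x => chainAutomaton.historyValuation h x + d)
      (OnOldestChain (timestamps (h.map Prod.fst ++ [d])) h.length)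
    exact ⟨τ, ⟨h1, h2, rfl, h3⟩, fun h => h4 (h2 ▸ h)⟩
  choose r hr hpick using key
  refine ⟨r, fun w => ?_⟩
  have hrun := TimedAutomaton.isRun_resolvedRun hr w
  refine ⟨hrun, fun n hsrc hle => ?_⟩
  rw [hrun.step]
  have hlist : (chainAutomaton.resolvedHistory r w n).map Prod.fst ++ [w.delay n] =
      (List.range (n + 1)).map w.delay := by
    simp [resolvedHistory_map_fst, List.range_succ]
  have hlen : (chainAutomaton.resolvedHistory r w n).length = n := by
    have := congrArg List.length (resolvedHistory_map_fst r w n)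
    simpa using this
  have := hpick (chainAutomaton.resolvedHistory r w n) (w.delay n) (w.letter n) hsrc (by
    rw [TimedAutomaton.historyValuation_resolvedHistory]; exact hle)
  rw [hlist, hlen] at this
  refine Iff.trans this ⟨fun h => h.congr fun i hi => timestamps_range w hi,
    fun h => h.congr fun i hi => (timestamps_range w hi).symm⟩

/-- A run that picks only the oldest chain accepts the words of the witness language. -/
theorem mem_acc_of_mem_unitDistanceLanguage (h : chainAutomaton.IsRun w ρ)
    (hpick : ∀ n, (ρ n).src ≠ tracking → clock w ρ n + w.delay n ≤ 1 →
      ((ρ (n + 1)).src = tracking ↔ OnOldestChain w.time n))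
    (hw : w ∈ unitDistanceLanguage) : ρ ∈ chainAutomaton.acc := by
  classical
  have hex : ∃ i, ∀ k : ℕ, ∃ j, w.time j = w.time i + k := by
    obtain ⟨i, hi⟩ := hw
    refine ⟨i, fun k => ?_⟩
    obtain ⟨j, -, hj⟩ := hi k
    refine ⟨j, NNReal.coe_injective ?_⟩
    push_cast
    linarith
  have hm := Nat.find_spec hex
  have hmin := fun m (hm : m < Nat.find hex) => Nat.find_min hex hm
  generalize Nat.find hex = m at hm hmin
  -- After some time, all chains older than that of event `m` have been broken.
  have hdead : ∃ N ≥ m, ∀ n ≥ N, ∀ m' < m, ¬ AliveAt w.time n m' := by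
    have h1 : ∀ m' : ℕ, ∃ N, m' < m → ∀ n ≥ N, ¬ AliveAt w.time n m' := by
      intro m'
      by_cases hm' : m' < m
      · have h2 := hmin m' hm'
        push Not at h2
        obtain ⟨k, hk⟩ := h2
        -- The chain of `m'` misses its link at `t m' + k`. As `t m' < t m`, the event at `t m + k +
        -- 1` comes later, so the break is visible from it on.
        obtain ⟨j, hj⟩ := hm (k + 1)
        refine ⟨j, fun _ n hn hal => ?_⟩
        obtain ⟨j', -, hj'⟩ := hal.2 k (by
          have h3 := w.strictMono_time.monotone hn
          have h4 := w.strictMono_time hm'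
          refine le_trans ?_ h3
          rw [hj]
          push_cast
          gcongr
          exact le_self_add)
        exact hk j' hj'
      · exact ⟨0, fun h => absurd h hm'⟩
    choose N hN using h1
    -- The sum is a crude common upper bound for the finitely many thresholds.
    refine ⟨m + ∑ i ∈ Finset.range m, N i, by omega, fun n hn m' hm' => hN m' hm' n ?_⟩
    have := Finset.single_le_sum (f := N) (fun _ _ => Nat.zero_le _) (Finset.mem_range.2 hm')
    omega
  obtain ⟨N, hNm, hN⟩ := hdead
  have halive : ∀ n ≥ m, AliveAt w.time n m := fun n hn =>
    ⟨hn, fun k hk => by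
      obtain ⟨j, hj⟩ := hm k
      exact ⟨j, w.strictMono_time.le_iff_le.1 (hj.trans_le hk), hj⟩⟩
  have honchain : ∀ n ≥ N, OnOldestChain w.time n ↔ ∃ k : ℕ, w.time n = w.time m + k := by
    intro n hn
    constructor
    · rintro ⟨m', h1, h2, h3⟩
      rcases lt_trichotomy m' m with h | rfl | h
      · exact absurd h1 (hN n hn m' h)
      · exact h3
      · exact absurd (halive n (by omega)) (h2 m h)
    · exact fun h => ⟨m, halive n (by omega), hN n hn, h⟩
  rw [mem_acc_iff]
  by_contra! hM
  obtain ⟨n, hn, hrej⟩ := hM (N + 1)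
  obtain ⟨n, rfl⟩ := Nat.exists_eq_succ_of_ne_zero (show n ≠ 0 by omega)
  rw [Nat.succ_eq_add_one] at hrej hn
  have hn0 : clock w ρ (n + 1) = 0 := by
    rcases run_cases h n with h | h | h | h | h <;> simp_all
  -- The next event on the chain of event `m` comes within one time unit.
  have hnext : ∃ c, n < c ∧ ∃ k : ℕ, w.time c = w.time m + k := by
    obtain ⟨k, hk⟩ := exists_nat_gt (w.time n)
    obtain ⟨c, hc⟩ := hm k
    exact ⟨c, w.strictMono_time.lt_iff_lt.1 (hk.trans_le (hc ▸ le_add_self)), k, hc⟩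
  obtain ⟨hnc, k, hk⟩ := Nat.find_spec hnext
  have hcmin := fun j (hj : j < Nat.find hnext) => Nat.find_min hnext hj
  generalize Nat.find hnext = c at hnc hk hcmin
  -- Otherwise the preceding link of the chain would also come after event `n`, against the
  -- minimality of `c`. It exists because `k = 0` would give `c = m ≤ n`.
  have hc1 : w.time c ≤ w.time n + 1 := by
    by_contra! hlt
    have hk0 : k ≠ 0 := by
      rintro rfl
      have := w.strictMono_time.injective (hk.trans (by simp : w.time m + (0 : ℕ) = w.time m))
      omega
    obtain ⟨k, rfl⟩ := Nat.exists_eq_succ_of_ne_zero hk0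
    obtain ⟨j, hj⟩ := hm k
    have h1 : w.time j < w.time c := by rw [hj, hk]; gcongr; exact k.lt_succ_self
    have h2 : w.time n < w.time j := by
      have h3 : w.time c = w.time j + 1 := by rw [hj, hk]; push_cast; ring
      rw [h3] at hlt
      exact lt_of_add_lt_add_right hlt
    exact hcmin j (w.strictMono_time.lt_iff_lt.1 h1) ⟨w.strictMono_time.lt_iff_lt.1 h2, k, hj⟩
  -- The rejection reset the clock, so no deadline is missed up to event `c`.
  have hle : ∀ j, n ≤ j → j < c → clock w ρ (j + 1) + w.delay (j + 1) ≤ 1 := by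
    intro j hj hjc
    have h1 := clock_add_time_le h hj
    rw [hn0, zero_add] at h1
    have h2 : w.time (j + 1) ≤ w.time n + 1 :=
      (w.strictMono_time.monotone (show j + 1 ≤ c by omega)).trans hc1
    rw [← w.time_add_delay] at h2
    refine le_of_add_le_add_left (a := w.time n) (le_trans ?_ h2)
    calc w.time n + (clock w ρ (j + 1) + w.delay (j + 1))
        = clock w ρ (j + 1) + w.time n + w.delay (j + 1) := by ring
      _ ≤ _ := by gcongr
  -- No event strictly between `n` and `c` is on the oldest chain, so the resolver does not commit
  -- to a wrong one.
  have hsearch : ∀ j, n ≤ j → j < c → (ρ (j + 1)).src ≠ tracking := by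
    intro j hj
    induction j, hj using Nat.le_induction with
    | base => exact fun _ ht => by cases hrej.symm.trans ht
    | succ j hj ih =>
      intro hjc ht
      have h1 := (hpick (j + 1) (ih (by omega)) (hle j hj (by omega))).1 ht
      exact hcmin (j + 1) hjc ⟨by omega, (honchain _ (by omega)).1 h1⟩
  -- From then on, the run follows the chain of event `m`.
  have htrack : ∀ j ≥ c, (ρ (j + 1)).src = tracking ∧ ∃ i ≤ j,
      (∃ k : ℕ, w.time i = w.time m + k) ∧ w.time j < w.time i + 1 ∧
        clock w ρ (j + 1) + w.time i = w.time j := by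
    intro j hj
    induction j, hj using Nat.le_induction with
    | base =>
      obtain ⟨c, rfl⟩ := Nat.exists_eq_succ_of_ne_zero (show c ≠ 0 by omega)
      have h1 := hsearch c (by omega) (by omega)
      have h2 := hle c (by omega) (by omega)
      have h3 := (hpick (c + 1) h1 h2).2 ((honchain _ (by omega)).2 ⟨k, hk⟩)
      refine ⟨h3, c + 1, le_rfl, ⟨k, hk⟩, lt_add_one _, ?_⟩
      rcases run_cases h (c + 1) with h | h | h | h | h <;> simp_all
    | succ j hj ih =>
      obtain ⟨hsrc, i, hij, ⟨k', hk'⟩, hlt, heq⟩ := ih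
      have hdl := w.time_add_delay j
      -- The next link `e`, one unit after the last followed event `i`, does occur. Hence event `j +
      -- 1` is not later than it, and `fail` is impossible.
      obtain ⟨e, he⟩ := hm (k' + 1)
      have he' : w.time e = w.time i + 1 := by rw [he, hk']; push_cast; ring
      have hje : w.time (j + 1) ≤ w.time i + 1 := by
        rw [← he'] at hlt ⊢
        exact w.strictMono_time.monotone (w.strictMono_time.lt_iff_lt.1 hlt)
      have hx : clock w ρ (j + 1) + w.delay (j + 1) + w.time i = w.time (j + 1) := by
        rw [← hdl, ← heq]; ring
      rcases run_cases h (j + 1) with h | h | h | h | h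
      · exact absurd hsrc h.2.1
      · exact absurd hsrc h.2.1
      · refine ⟨h.2.2.1, i, by omega, ⟨k', hk'⟩, ?_, by rw [h.2.2.2, hx]⟩
        rw [← hx, add_comm (w.time i)]
        gcongr
        exact h.1
      · refine ⟨h.2.2.1, j + 1, le_rfl, ⟨k' + 1, ?_⟩, lt_add_one _, by rw [h.2.2.2, zero_add]⟩
        rw [← hx, h.1, hk']
        push_cast
        ring
      · refine absurd h.1 (not_lt.2 (le_of_add_le_add_right (a := w.time i) ?_))
        rw [hx, add_comm 1]
        exact hje
  obtain ⟨i, hi, hirej⟩ := hM (c + 1)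
  obtain ⟨i, rfl⟩ := Nat.exists_eq_succ_of_ne_zero (show i ≠ 0 by omega)
  have := (htrack i (by omega)).1
  rw [Nat.succ_eq_add_one, this] at hirej
  cases hirej

/-! ### Language and history-determinism of the chain automaton -/

theorem isHistoryDeterministic_univ_and_language :
    chainAutomaton.IsHistoryDeterministic Set.univ ∧
      chainAutomaton.language Set.univ = unitDistanceLanguage ∪ zenoWords Unit := by
  obtain ⟨r, hr⟩ := exists_resolver
  have hsub : chainAutomaton.language Set.univ ⊆ unitDistanceLanguage ∪ zenoWords Unit := by
    rintro w ⟨-, ρ, hρ, hacc⟩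
    by_cases hw : w.IsZeno
    · exact .inr hw
    · exact .inl (mem_unitDistanceLanguage hρ hw hacc)
  have hacc : ∀ w ∈ unitDistanceLanguage ∪ zenoWords Unit,
      chainAutomaton.resolvedRun r w ∈ chainAutomaton.acc := by
    rintro w (hw | hw)
    · exact mem_acc_of_mem_unitDistanceLanguage (hr w).1 (hr w).2 hw
    · exact mem_acc_of_isZeno (hr w).1 hw
  exact ⟨⟨r, fun w _ => (hr w).1, fun w hw => hacc w (hsub hw)⟩,
    hsub.antisymm fun w hw => ⟨trivial, _, (hr w).1, hacc w hw⟩⟩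

theorem isHistoryDeterministic (W : Set (TimedWord Unit)) :
    chainAutomaton.IsHistoryDeterministic W :=
  isHistoryDeterministic_univ_and_language.1.mono (Set.subset_univ W)

theorem language_univ :
    chainAutomaton.language Set.univ = unitDistanceLanguage ∪ zenoWords Unit :=
  isHistoryDeterministic_univ_and_language.2

theorem language_nonZenoWords :
    chainAutomaton.language (nonZenoWords Unit) = unitDistanceLanguage := by
  have h := Set.ext_iff.1 language_univ
  ext w
  constructor
  · rintro ⟨hw, hacc⟩
    exact ((h w).1 ⟨trivial, hacc⟩).resolve_right hw
  · exact fun hw => ⟨unitDistanceLanguage_subset_nonZenoWords hw, ((h w).2 (.inl hw)).2⟩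

theorem card_clock : Nat.card chainAutomaton.Clock = 1 := Nat.card_unique (α := Unit)

end chainAutomaton

/-! ### Guards and the order of fractional parts -/

/-- Since `|e - f| < 1`, the integral parts decide the comparison except in a tie. -/
theorem natCast_add_sub_lt_iff {m k n : ℕ} {e f : ℝ} (he : 0 ≤ e ∧ e < 1) (hf : 0 ≤ f ∧ f < 1) :
    ((m + e) - (k + f) < (n : ℝ)) ↔ m < n + k ∨ (m = n + k ∧ e < f) := by
  rcases lt_trichotomy m (n + k) with h | h | h
  · have h1 : (m : ℝ) + 1 ≤ n + k := by exact_mod_cast h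
    exact ⟨fun _ => .inl h, fun _ => by linarith⟩
  · have h1 : (m : ℝ) = n + k := by exact_mod_cast h
    refine ⟨fun h2 => .inr ⟨h, by linarith⟩, ?_⟩
    rintro (h2 | ⟨-, h2⟩)
    · omega
    · linarith
  · have h1 : (n : ℝ) + k + 1 ≤ m := by exact_mod_cast h
    refine ⟨fun h2 => by linarith, ?_⟩
    rintro (h2 | ⟨h2, -⟩) <;> omega

theorem natCast_add_sub_le_iff {m k n : ℕ} {e f : ℝ} (he : 0 ≤ e ∧ e < 1) (hf : 0 ≤ f ∧ f < 1) :
    ((m + e) - (k + f) ≤ (n : ℝ)) ↔ m < n + k ∨ (m = n + k ∧ ¬ f < e) := by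
  rcases lt_trichotomy m (n + k) with h | h | h
  · have h1 : (m : ℝ) + 1 ≤ n + k := by exact_mod_cast h
    exact ⟨fun _ => .inl h, fun _ => by linarith⟩
  · have h1 : (m : ℝ) = n + k := by exact_mod_cast h
    refine ⟨fun h2 => .inr ⟨h, by linarith⟩, ?_⟩
    rintro (h2 | ⟨-, h2⟩)
    · omega
    · linarith
  · have h1 : (n : ℝ) + k + 1 ≤ m := by exact_mod_cast h
    refine ⟨fun h2 => by linarith, ?_⟩
    rintro (h2 | ⟨h2, -⟩) <;> omega

/-- The current time is `m none + e none`, and clock `x` was reset at time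
`m (some x) + e (some x)`. Whether a guard holds depends only on the integral parts `m` and on the
order of the fractional parts `e`. -/
theorem Guard.sat_iff_of_fract_order {C : Type} {m : Option C → ℕ} {e e' : Option C → ℝ}
    (he : ∀ v, 0 ≤ e v ∧ e v < 1) (he' : ∀ v, 0 ≤ e' v ∧ e' v < 1)
    (hord : ∀ u v, e u < e v ↔ e' u < e' v) {ν ν' : C → ℝ≥0}
    (hν : ∀ x, (ν x : ℝ) = (m none + e none) - (m (some x) + e (some x)))
    (hν' : ∀ x, (ν' x : ℝ) = (m none + e' none) - (m (some x) + e' (some x))) (g : Guard C) :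
    g.Sat ν ↔ g.Sat ν' := by
  -- The constant `0` behaves like a clock reset just now, so with `none` as the current time every
  -- constraint compares two reset times.
  have hd : ∀ x y, (ν x : ℝ) - clockValue ν y = (m y + e y) - (m (some x) + e (some x)) := by
    rintro x (_ | y) <;> simp only [clockValue, hν] <;> ring
  have hd' : ∀ x y, (ν' x : ℝ) - clockValue ν' y = (m y + e' y) - (m (some x) + e' (some x)) := by
    rintro x (_ | y) <;> simp only [clockValue, hν'] <;> ring
  induction g with
  | tt => rfl
  | lt x y n =>
    rw [Guard.Sat, Guard.Sat, hd, hd', natCast_add_sub_lt_iff (he _) (he _),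
      natCast_add_sub_lt_iff (he' _) (he' _), hord]
  | le x y n =>
    rw [Guard.Sat, Guard.Sat, hd, hd', natCast_add_sub_le_iff (he _) (he _),
      natCast_add_sub_le_iff (he' _) (he' _), hord]
  | not g ih => exact not_congr ih
  | and g h ih₁ ih₂ => exact and_congr ih₁ ih₂
  | or g h ih₁ ih₂ => exact or_congr ih₁ ih₂

/-! ### The last reset of a clock -/

namespace TimedWord

variable {A : Type}

/-- Time `0`, followed by the timestamps of the word. -/
def point (w : TimedWord A) : ℕ → ℝ≥0
  | 0 => 0
  | n + 1 => w.time n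

theorem point_add_delay (w : TimedWord A) (n : ℕ) :
    w.point n + w.delay n = w.point (n + 1) := by
  cases n with
  | zero => simp [point, delay]
  | succ n => exact w.time_add_delay n

end TimedWord

namespace TimedAutomaton

variable {A : Type} {T : TimedAutomaton A}

open Classical in
/-- The number of events up to and including the last one, among the first `n`, that resets the
clock `x`, and `0` if there is none. -/
noncomputable def lastReset (ρ : ℕ → T.Trans) : ℕ → T.Clock → ℕ
  | 0, _ => 0
  | n + 1, x => if x ∈ (ρ n).reset then n + 1 else lastReset ρ n x

theorem lastReset_succ_of_mem {ρ : ℕ → T.Trans} {n : ℕ} {x : T.Clock} (h : x ∈ (ρ n).reset) :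
    lastReset ρ (n + 1) x = n + 1 := if_pos h

theorem lastReset_succ_of_notMem {ρ : ℕ → T.Trans} {n : ℕ} {x : T.Clock} (h : x ∉ (ρ n).reset) :
    lastReset ρ (n + 1) x = lastReset ρ n x := if_neg h

theorem lastReset_le (ρ : ℕ → T.Trans) (n : ℕ) (x : T.Clock) : lastReset ρ n x ≤ n := by
  induction n with
  | zero => exact le_rfl
  | succ n ih =>
    by_cases h : x ∈ (ρ n).reset
    · exact (lastReset_succ_of_mem h).le
    · rw [lastReset_succ_of_notMem h]; omega

theorem lastReset_eq_of_le {ρ : ℕ → T.Trans} {s n : ℕ} {x : T.Clock} (hs : s ≤ n)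
    (h : lastReset ρ n x ≤ s) : lastReset ρ n x = lastReset ρ s x := by
  induction n, hs using Nat.le_induction with
  | base => rfl
  | succ n hn ih =>
    by_cases hx : x ∈ (ρ n).reset
    · rw [lastReset_succ_of_mem hx] at h; omega
    · rw [lastReset_succ_of_notMem hx] at h ⊢
      exact ih h

theorem mem_reset_of_lastReset_eq {ρ : ℕ → T.Trans} {i n : ℕ} {x : T.Clock}
    (h : lastReset ρ n x = i + 1) :
    x ∈ (ρ i).reset ∧ ∀ m, i < m → m < n → x ∉ (ρ m).reset := by
  induction n with
  | zero => simp [lastReset] at h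
  | succ n ih =>
    by_cases hx : x ∈ (ρ n).reset
    · rw [lastReset_succ_of_mem hx] at h
      obtain rfl : n = i := by omega
      exact ⟨hx, fun m h1 h2 => by omega⟩
    · rw [lastReset_succ_of_notMem hx] at h
      obtain ⟨h1, h2⟩ := ih h
      refine ⟨h1, fun m hm hm' => ?_⟩
      rcases (Nat.lt_succ_iff.1 hm').lt_or_eq with h3 | rfl
      · exact h2 m hm h3
      · exact hx

theorem valuation_add_point (w : TimedWord A) (ρ : ℕ → T.Trans) (n : ℕ) (x : T.Clock) :
    T.valuation w ρ n x + w.point (lastReset ρ n x) = w.point n := by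
  induction n with
  | zero => simp [valuation, lastReset]
  | succ n ih =>
    by_cases hx : x ∈ (ρ n).reset
    · simp [valuation, resetClocks, hx, lastReset_succ_of_mem hx]
    · rw [lastReset_succ_of_notMem hx, valuation, resetClocks, if_neg hx, add_right_comm, ih,
        w.point_add_delay]

/-- The value of a clock is the time since its last reset. -/
theorem valuation_add_delay (w : TimedWord A) (ρ : ℕ → T.Trans) (n : ℕ) (x : T.Clock) :
    ((T.valuation w ρ n x + w.delay n : ℝ≥0) : ℝ) =
      w.point (n + 1) - w.point (lastReset ρ n x) := by
  rw [← w.point_add_delay, ← valuation_add_point w ρ n x]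
  push_cast
  ring

end TimedAutomaton

/-! ### Two words that are hard to tell apart

There are `2 * B + 1` events in each time unit. The fractional parts of the middle events are all
equal to `1 / 2` in the word `middleWord B false`, and they are pairwise distinct in the word
`middleWord B true`. The other events get closer to the middle in each time unit. -/

namespace middleWord

/-- The fractional part of the timestamp of event number `p` in time unit `n`. -/
noncomputable def offset (B : ℕ) (b : Bool) (n p : ℕ) : ℝ :=
  if p < B then 1 / 2 - 1 / (((n * (2 * B + 1) + p : ℕ) : ℝ) + 3)
  else if p = B ∧ b = false then 1 / 2
  else 1 / 2 + 1 / (((n * (2 * B + 1) + (2 * B + 1 - p) : ℕ) : ℝ) + 3)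

variable {B : ℕ}

theorem one_div_lt_one_div {m n : ℕ} (h : m < n) : 1 / ((n : ℝ) + 3) < 1 / ((m : ℝ) + 3) := by
  have : (m : ℝ) < n := by exact_mod_cast h
  gcongr

theorem one_div_pos (n : ℕ) : 0 < 1 / ((n : ℝ) + 3) := by positivity

/-- The shift by `3` in `offset` serves this bound, which keeps all offsets strictly between `0` and
`1`. -/
theorem one_div_lt_half (n : ℕ) : 1 / ((n : ℝ) + 3) < 1 / 2 := by
  have : (0 : ℝ) ≤ n := n.cast_nonneg
  gcongr
  linarith

theorem offset_pos (b : Bool) (n p : ℕ) : 0 < offset B b n p := by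
  have h1 := one_div_lt_half (n * (2 * B + 1) + p)
  have h2 := one_div_pos (n * (2 * B + 1) + (2 * B + 1 - p))
  unfold offset
  split_ifs <;> linarith

theorem offset_lt_one (b : Bool) (n p : ℕ) : offset B b n p < 1 := by
  have h1 := one_div_pos (n * (2 * B + 1) + p)
  have h2 := one_div_lt_half (n * (2 * B + 1) + (2 * B + 1 - p))
  unfold offset
  split_ifs <;> linarith

theorem offset_lt_half {p : ℕ} (b : Bool) (n : ℕ) (hp : p < B) : offset B b n p < 1 / 2 := by
  have h1 := one_div_pos (n * (2 * B + 1) + p)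
  rw [offset, if_pos hp]
  linarith

theorem half_le_offset {p : ℕ} (b : Bool) (n : ℕ) (hp : B ≤ p) : 1 / 2 ≤ offset B b n p := by
  have h1 := one_div_pos (n * (2 * B + 1) + (2 * B + 1 - p))
  rw [offset, if_neg hp.not_gt]
  split_ifs <;> linarith

theorem offset_of_gt {p : ℕ} (b : Bool) (n : ℕ) (hp : B < p) : offset B b n p =
    1 / 2 + 1 / (((n * (2 * B + 1) + (2 * B + 1 - p) : ℕ) : ℝ) + 3) := by
  rw [offset, if_neg hp.le.not_gt, if_neg fun h => hp.ne' h.1]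

theorem offset_le {p : ℕ} (b : Bool) (n : ℕ) (hp : B ≤ p) : offset B b n p ≤
    1 / 2 + 1 / (((n * (2 * B + 1) + (2 * B + 1 - p) : ℕ) : ℝ) + 3) := by
  have h1 := one_div_pos (n * (2 * B + 1) + (2 * B + 1 - p))
  rw [offset, if_neg hp.not_gt]
  split_ifs <;> linarith

theorem offset_eq {p : ℕ} (b b' : Bool) (n : ℕ) (hp : p ≠ B) :
    offset B b n p = offset B b' n p := by
  simp [offset, hp]

theorem offset_lt_offset {p p' : ℕ} (b : Bool) (n : ℕ) (hp : p < p') (hp' : p' < 2 * B + 1) :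
    offset B b n p < offset B b n p' := by
  by_cases h : p < B
  · by_cases h' : p' < B
    · have := one_div_lt_one_div (show n * (2 * B + 1) + p < n * (2 * B + 1) + p' by omega)
      rw [offset, offset, if_pos h, if_pos h']
      linarith
    · exact (offset_lt_half b n h).trans_le (half_le_offset b n (not_lt.1 h'))
  · have h1 := offset_le b n (not_lt.1 h)
    have h2 := offset_of_gt b n (show B < p' by omega)
    have h3 := one_div_lt_one_div (show n * (2 * B + 1) + (2 * B + 1 - p') <
      n * (2 * B + 1) + (2 * B + 1 - p) by omega)
    linarith

theorem mul_add_le_mul {n n' K : ℕ} (h : n < n') : n * K + K ≤ n' * K := by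
  rw [← Nat.succ_mul]
  exact Nat.mul_le_mul_right K h

/-- The denominators on the left keep growing from unit to unit, so an old left event lies below
everything in a later unit. `offset_lt_offset_of_gt` is the mirror image. -/
theorem offset_lt_offset_of_lt {n n' p p' : ℕ} (b : Bool) (hp : p < B) (hn : n < n') :
    offset B b n p < offset B b n' p' := by
  by_cases h' : p' < B
  · have h1 := mul_add_le_mul (K := 2 * B + 1) hn
    have := one_div_lt_one_div (show n * (2 * B + 1) + p < n' * (2 * B + 1) + p' by omega)
    rw [offset, offset, if_pos hp, if_pos h']
    linarith
  · exact (offset_lt_half b n hp).trans_le (half_le_offset b n' (not_lt.1 h'))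

theorem offset_lt_offset_of_gt {n n' p p' : ℕ} (b : Bool) (hp : B < p) (hn : n < n')
    (hp' : p' < 2 * B + 1) : offset B b n' p' < offset B b n p := by
  by_cases h' : p' < B
  · exact (offset_lt_half b n' h').trans_le (half_le_offset b n hp.le)
  · have h0 := mul_add_le_mul (K := 2 * B + 1) hn
    have h1 := offset_le b n' (not_lt.1 h')
    have h2 := offset_of_gt b n hp
    have h3 := one_div_lt_one_div (show n * (2 * B + 1) + (2 * B + 1 - p) <
      n' * (2 * B + 1) + (2 * B + 1 - p') by omega)
    linarith

/-- With the middle events perturbed too, no fractional part recurs in another unit; this rules out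
events at distance one. -/
theorem offset_true_injective {n n' p p' : ℕ} (hp : p < 2 * B + 1) (hp' : p' < 2 * B + 1)
    (h : offset B true n p = offset B true n' p') : n = n' := by
  by_contra hne
  wlog hn : n < n' generalizing n n' p p'
  · exact this hp' hp h.symm (Ne.symm hne) (by omega)
  rcases lt_trichotomy p B with h1 | rfl | h1
  · exact (offset_lt_offset_of_lt true h1 hn).ne h
  · by_cases h2 : p' < p
    · exact ((offset_lt_half true n' h2).trans_le (half_le_offset true n le_rfl)).ne h.symm
    · have h3 := mul_add_le_mul (K := 2 * p + 1) hn
      have h4 := offset_le true n' (not_lt.1 h2)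
      have h5 : offset p true n p =
          1 / 2 + 1 / (((n * (2 * p + 1) + (2 * p + 1 - p) : ℕ) : ℝ) + 3) := by simp [offset]
      have h6 := one_div_lt_one_div (show n * (2 * p + 1) + (2 * p + 1 - p) <
        n' * (2 * p + 1) + (2 * p + 1 - p') by omega)
      linarith
  · exact (offset_lt_offset_of_gt true h1 hn hp').ne h.symm

/-- The integral part of the time of the `a`-th point, where point `0` is time `0` and point
`i + 1` is event `i`. -/
def unit (B : ℕ) : ℕ → ℕ
  | 0 => 0
  | i + 1 => i / (2 * B + 1)

/-- The fractional part of the time of the `a`-th point. -/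
noncomputable def frac (B : ℕ) (b : Bool) : ℕ → ℝ
  | 0 => 0
  | i + 1 => offset B b (i / (2 * B + 1)) (i % (2 * B + 1))

/-- The points that are middle events. -/
def IsMiddle (B a : ℕ) : Prop := ∃ n, a = n * (2 * B + 1) + B + 1

theorem frac_mem (b : Bool) (a : ℕ) : 0 ≤ frac B b a ∧ frac B b a < 1 := by
  cases a with
  | zero => simp [frac]
  | succ i => exact ⟨(offset_pos _ _ _).le, offset_lt_one _ _ _⟩

theorem exists_eq_of_lt {n a : ℕ} (h1 : n * (2 * B + 1) < a) (h2 : a ≤ (n + 1) * (2 * B + 1)) :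
    ∃ p < 2 * B + 1, a = n * (2 * B + 1) + p + 1 := by
  rw [Nat.succ_mul] at h2
  exact ⟨a - n * (2 * B + 1) - 1, by omega, by omega⟩

theorem unit_eq {n p : ℕ} (hp : p < 2 * B + 1) : unit B (n * (2 * B + 1) + p + 1) = n := by
  rw [unit, mul_comm, Nat.mul_add_div (by omega), Nat.div_eq_of_lt hp, add_zero]

theorem frac_eq_offset (b : Bool) {n p : ℕ} (hp : p < 2 * B + 1) :
    frac B b (n * (2 * B + 1) + p + 1) = offset B b n p := by
  rw [frac, mul_comm, Nat.mul_add_div (by omega), Nat.div_eq_of_lt hp, add_zero, Nat.mul_add_mod,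
    Nat.mod_eq_of_lt hp]

theorem exists_eq_mul_add (i : ℕ) : ∃ n, ∃ p < 2 * B + 1, i = n * (2 * B + 1) + p :=
  ⟨i / (2 * B + 1), i % (2 * B + 1), Nat.mod_lt _ (by omega), (Nat.div_add_mod' _ _).symm⟩

theorem frac_eq_frac (b b' : Bool) {a : ℕ} (ha : ¬ IsMiddle B a) : frac B b a = frac B b' a := by
  cases a with
  | zero => rfl
  | succ i =>
    obtain ⟨n, p, hp, rfl⟩ := exists_eq_mul_add (B := B) i
    rw [frac_eq_offset b hp, frac_eq_offset b' hp]
    exact offset_eq b b' n fun h => ha ⟨n, by rw [h]⟩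

theorem frac_lt_frac_iff (b : Bool) {n a a' : ℕ} (h1 : n * (2 * B + 1) < a)
    (h2 : a ≤ (n + 1) * (2 * B + 1)) (h1' : n * (2 * B + 1) < a')
    (h2' : a' ≤ (n + 1) * (2 * B + 1)) : frac B b a < frac B b a' ↔ a < a' := by
  obtain ⟨p, hp, rfl⟩ := exists_eq_of_lt h1 h2
  obtain ⟨p', hp', rfl⟩ := exists_eq_of_lt h1' h2'
  rw [frac_eq_offset b hp, frac_eq_offset b hp']
  rcases lt_trichotomy p p' with h | rfl | h
  · exact ⟨fun _ => by omega, fun _ => offset_lt_offset b n h hp'⟩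
  · simp
  · exact ⟨fun h' => absurd h' (offset_lt_offset b n h hp).not_gt, fun h' => by omega⟩

/-- A point that is not a middle event does not separate the fractional parts of the events of a
later time unit. -/
theorem frac_separation {n a : ℕ} (h : a ≤ n * (2 * B + 1)) (ha : ¬ IsMiddle B a) :
    (∀ b a', n * (2 * B + 1) < a' → a' ≤ (n + 1) * (2 * B + 1) → frac B b a < frac B b a') ∨
    (∀ b a', n * (2 * B + 1) < a' → a' ≤ (n + 1) * (2 * B + 1) → frac B b a' < frac B b a) := by
  cases a with
  | zero =>
    refine .inl fun b a' h1 h2 => ?_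
    obtain ⟨p, hp, rfl⟩ := exists_eq_of_lt h1 h2
    exact offset_pos _ _ _
  | succ i =>
    obtain ⟨m, p, hp, rfl⟩ := exists_eq_mul_add (B := B) i
    have hm : m < n := Nat.lt_of_mul_lt_mul_right (a := 2 * B + 1) (by omega)
    have hpB : p ≠ B := fun h => ha ⟨m, by rw [h]⟩
    rcases hpB.lt_or_gt with h | h
    · refine .inl fun b a' h1 h2 => ?_
      obtain ⟨p', hp', rfl⟩ := exists_eq_of_lt h1 h2
      rw [frac_eq_offset b hp, frac_eq_offset b hp']
      exact offset_lt_offset_of_lt b h hm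
    · refine .inr fun b a' h1 h2 => ?_
      obtain ⟨p', hp', rfl⟩ := exists_eq_of_lt h1 h2
      rw [frac_eq_offset b hp, frac_eq_offset b hp']
      exact offset_lt_offset_of_gt b h hm hp'

/-- The points `a v` and `a' v` are the same point before time unit `n`, not a middle event, or both
are events of time unit `n`. If the latter have the same order, then the fractional parts of all
these points have the same order. -/
theorem frac_order_congr {I : Type} {n : ℕ} (b b' : Bool) {a a' : I → ℕ}
    (h : ∀ v, (a v ≤ n * (2 * B + 1) ∧ a' v = a v ∧ ¬ IsMiddle B (a v)) ∨
      ((n * (2 * B + 1) < a v ∧ a v ≤ (n + 1) * (2 * B + 1)) ∧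
        (n * (2 * B + 1) < a' v ∧ a' v ≤ (n + 1) * (2 * B + 1))))
    (hord : ∀ u v, n * (2 * B + 1) < a u → n * (2 * B + 1) < a v → (a u < a v ↔ a' u < a' v))
    (u v : I) : frac B b (a u) < frac B b (a v) ↔ frac B b' (a' u) < frac B b' (a' v) := by
  rcases h u with ⟨h1, h2, h3⟩ | ⟨h1, h2⟩ <;> rcases h v with ⟨h1', h2', h3'⟩ | ⟨h1', h2'⟩
  · rw [h2, h2', frac_eq_frac b b' h3, frac_eq_frac b b' h3']
  · rw [h2]
    rcases frac_separation h1 h3 with h | h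
    · exact iff_of_true (h b _ h1'.1 h1'.2) (h b' _ h2'.1 h2'.2)
    · exact iff_of_false (h b _ h1'.1 h1'.2).not_gt (h b' _ h2'.1 h2'.2).not_gt
  · rw [h2']
    rcases frac_separation h1' h3' with h | h
    · exact iff_of_false (h b _ h1.1 h1.2).not_gt (h b' _ h2.1 h2.2).not_gt
    · exact iff_of_true (h b _ h1.1 h1.2) (h b' _ h2.1 h2.2)
  · rw [frac_lt_frac_iff b h1.1 h1.2 h1'.1 h1'.2, frac_lt_frac_iff b' h2.1 h2.2 h2'.1 h2'.2]
    exact hord u v h1.1 h1'.1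

theorem unit_congr {n a a' : ℕ}
    (h : (a ≤ n * (2 * B + 1) ∧ a' = a ∧ ¬ IsMiddle B a) ∨
      ((n * (2 * B + 1) < a ∧ a ≤ (n + 1) * (2 * B + 1)) ∧
        (n * (2 * B + 1) < a' ∧ a' ≤ (n + 1) * (2 * B + 1)))) : unit B a' = unit B a := by
  rcases h with ⟨-, rfl, -⟩ | ⟨h1, h2⟩
  · rfl
  · obtain ⟨p, hp, rfl⟩ := exists_eq_of_lt h1.1 h1.2
    obtain ⟨p', hp', rfl⟩ := exists_eq_of_lt h2.1 h2.2
    rw [unit_eq hp, unit_eq hp']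

end middleWord

open middleWord in
/-- The middle events have the same fractional part iff `b = false`. -/
noncomputable def middleWord (B : ℕ) (b : Bool) : TimedWord Unit where
  letter _ := ()
  time i := ⟨unit B (i + 1) + frac B b (i + 1), add_nonneg (Nat.cast_nonneg _) (frac_mem b _).1⟩
  strictMono_time := by
    intro i j hij
    refine NNReal.coe_lt_coe.1 ?_
    change (unit B (i + 1) : ℝ) + frac B b (i + 1) < unit B (j + 1) + frac B b (j + 1)
    obtain ⟨n, p, hp, rfl⟩ := exists_eq_mul_add (B := B) i
    obtain ⟨m, q, hq, rfl⟩ := exists_eq_mul_add (B := B) j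
    rw [unit_eq hp, unit_eq hq, frac_eq_offset b hp, frac_eq_offset b hq]
    rcases lt_trichotomy n m with h | rfl | h
    · have h1 : (n : ℝ) + 1 ≤ m := by exact_mod_cast h
      have h2 := offset_lt_one (B := B) b n p
      have h3 := offset_pos (B := B) b m q
      linarith
    · have := offset_lt_offset b n (show p < q by omega) hq
      linarith
    · have := mul_add_le_mul (K := 2 * B + 1) h
      omega

namespace middleWord

variable {B : ℕ}

theorem coe_time (b : Bool) {n p : ℕ} (hp : p < 2 * B + 1) :
    ((middleWord B b).time (n * (2 * B + 1) + p) : ℝ) = n + offset B b n p := by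
  change (unit B (n * (2 * B + 1) + p + 1) : ℝ) + frac B b (n * (2 * B + 1) + p + 1) = _
  rw [unit_eq hp, frac_eq_offset b hp]

theorem coe_point (b : Bool) (a : ℕ) :
    ((middleWord B b).point a : ℝ) = unit B a + frac B b a := by
  cases a with
  | zero => simp [TimedWord.point, unit, frac]
  | succ i => rfl

theorem not_isZeno (b : Bool) : ¬ (middleWord B b).IsZeno := by
  rintro ⟨c, hc⟩
  obtain ⟨n, hn⟩ := exists_nat_gt c
  have h1 : (middleWord B b).time (n * (2 * B + 1) + 0) ≤ c := hc ⟨_, rfl⟩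
  have h2 : ((middleWord B b).time (n * (2 * B + 1) + 0) : ℝ) ≤ c := by exact_mod_cast h1
  have h3 : (c : ℝ) < n := by exact_mod_cast hn
  rw [coe_time b (by omega)] at h2
  have := offset_pos (B := B) b n 0
  linarith

theorem false_mem_unitDistanceLanguage : middleWord B false ∈ unitDistanceLanguage := by
  have h : ∀ n, offset B false n B = 1 / 2 := fun n => by simp [offset]
  refine ⟨0 * (2 * B + 1) + B, fun n => ⟨n * (2 * B + 1) + B, by simp, ?_⟩⟩
  rw [coe_time false (by omega), coe_time false (by omega), h, h]
  simp

theorem true_notMem_unitDistanceLanguage : middleWord B true ∉ unitDistanceLanguage := by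
  rintro ⟨i, hi⟩
  obtain ⟨j, -, hj⟩ := hi 1
  obtain ⟨n, p, hp, rfl⟩ := exists_eq_mul_add (B := B) i
  obtain ⟨m, q, hq, rfl⟩ := exists_eq_mul_add (B := B) j
  rw [coe_time true hp, coe_time true hq] at hj
  push_cast at hj
  have h1 := offset_lt_one (B := B) true n p
  have h2 := offset_pos (B := B) true n p
  have h3 := offset_lt_one (B := B) true m q
  have h4 := offset_pos (B := B) true m q
  have h5 : m = n + 1 := by
    have h6 : (m : ℝ) < ((n + 2 : ℕ) : ℝ) := by push_cast; linarith
    have h7 : (n : ℝ) < m := by linarith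
    have h6' : m < n + 2 := by exact_mod_cast h6
    have h7' : n < m := by exact_mod_cast h7
    omega
  have h8 := offset_true_injective (B := B) (n := m) (n' := n) hq hp (by
    rw [h5] at hj ⊢
    push_cast at hj
    linarith)
  omega

end middleWord

/-! ### Deterministic automata cannot tell the two words apart -/

namespace TimedAutomaton

open middleWord

variable {D : TimedAutomaton Unit} {B : ℕ} {ρ : ℕ → D.Trans}

/-- The point at which a clock was last reset before event `j`, and event `j` itself. -/
noncomputable def relevantPoint (ρ : ℕ → D.Trans) (j : ℕ) : Option D.Clock → ℕ
  | none => j + 1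
  | some x => lastReset ρ j x

/-- The same guards hold at two events of time unit `n` if their relevant points correspond. -/
theorem guard_sat_iff {n j j' : ℕ} (b b' : Bool)
    (h : ∀ v, (relevantPoint ρ j v ≤ n * (2 * B + 1) ∧ relevantPoint ρ j' v = relevantPoint ρ j v ∧
        ¬ IsMiddle B (relevantPoint ρ j v)) ∨
      ((n * (2 * B + 1) < relevantPoint ρ j v ∧ relevantPoint ρ j v ≤ (n + 1) * (2 * B + 1)) ∧
        (n * (2 * B + 1) < relevantPoint ρ j' v ∧
          relevantPoint ρ j' v ≤ (n + 1) * (2 * B + 1))))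
    (hord : ∀ u v, n * (2 * B + 1) < relevantPoint ρ j u → n * (2 * B + 1) < relevantPoint ρ j v →
      (relevantPoint ρ j u < relevantPoint ρ j v ↔ relevantPoint ρ j' u < relevantPoint ρ j' v))
    (g : Guard D.Clock) :
    g.Sat (fun x => D.valuation (middleWord B b) ρ j x + (middleWord B b).delay j) ↔
      g.Sat (fun x => D.valuation (middleWord B b') ρ j' x + (middleWord B b').delay j') := by
  refine Guard.sat_iff_of_fract_order (m := fun v => unit B (relevantPoint ρ j v))
    (e := fun v => frac B b (relevantPoint ρ j v))
    (e' := fun v => frac B b' (relevantPoint ρ j' v)) (fun v => frac_mem b _)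
    (fun v => frac_mem b' _) (frac_order_congr b b' h hord) (fun x => ?_) (fun x => ?_) g
  · rw [valuation_add_delay, coe_point, coe_point]
    rfl
  · rw [valuation_add_delay, coe_point, coe_point, ← unit_congr (h none), ← unit_congr (h (some x))]
    rfl

/-- The guards cannot tell the events `j` and `j'` of time unit `n` apart. -/
structure Similar (B : ℕ) (ρ : ℕ → D.Trans) (n j j' : ℕ) : Prop where
  src : (ρ j).src = (ρ j').src
  current : ∀ x, n * (2 * B + 1) < lastReset ρ j x ↔ n * (2 * B + 1) < lastReset ρ j' x
  order : ∀ x y, lastReset ρ j x < lastReset ρ j y ↔ lastReset ρ j' x < lastReset ρ j' y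

/-- Clocks last reset before the unit have the same reset point at `j` and `j'`, not a middle event,
and so do not separate the two; the others are compared by order alone. The same guards hold, and
determinism forces the same transition. -/
theorem Similar.eq {n j j' : ℕ} (h : Similar B ρ n j j') (hD : D.IsDeterministic)
    (hρ : D.IsRun (middleWord B false) ρ)
    (hmid : ∀ x, ¬ IsMiddle B (lastReset ρ (n * (2 * B + 1)) x))
    (h1 : n * (2 * B + 1) ≤ j) (h2 : j < (n + 1) * (2 * B + 1))
    (h1' : n * (2 * B + 1) ≤ j') (h2' : j' < (n + 1) * (2 * B + 1)) : ρ j = ρ j' := by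
  refine hD _ (hρ.mem j) _ (hρ.mem j') h.src rfl _ ((guard_sat_iff (n := n) (j := j) false false
    ?_ ?_ _).1 (hρ.guard j)) (hρ.guard j')
  · rintro (_ | x)
    · exact .inr ⟨⟨by simp only [relevantPoint]; omega, h2⟩,
        ⟨by simp only [relevantPoint]; omega, h2'⟩⟩
    · simp only [relevantPoint]
      have h3 := h.current x
      rcases le_or_gt (lastReset ρ j x) (n * (2 * B + 1)) with h4 | h4
      · have h5 := lastReset_eq_of_le h1 h4
        have h6 := lastReset_eq_of_le h1' (not_lt.1 (mt h3.2 h4.not_gt))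
        exact .inl ⟨h4, h6.trans h5.symm, h5 ▸ hmid x⟩
      · exact .inr ⟨⟨h4, (lastReset_le ρ j x).trans h2.le⟩,
          ⟨h3.1 h4, (lastReset_le ρ j' x).trans h2'.le⟩⟩
  · rintro (_ | x) (_ | y) - -
    · simp
    · have h3 := lastReset_le ρ j y
      have h4 := lastReset_le ρ j' y
      simp only [relevantPoint]
      omega
    · have h3 := lastReset_le ρ j x
      have h4 := lastReset_le ρ j' x
      simp only [relevantPoint]
      omega
    · exact h.order x y

theorem Similar.succ {n j j' : ℕ} {w : TimedWord Unit} (h : Similar B ρ n j j')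
    (hρ : D.IsRun w ρ) (h1 : n * (2 * B + 1) ≤ j) (h1' : n * (2 * B + 1) ≤ j')
    (heq : ρ j = ρ j') : Similar B ρ n (j + 1) (j' + 1) where
  src := by rw [hρ.step, hρ.step, heq]
  current x := by
    by_cases hx : x ∈ (ρ j).reset
    · rw [lastReset_succ_of_mem hx, lastReset_succ_of_mem (heq ▸ hx)]
      omega
    · rw [lastReset_succ_of_notMem hx, lastReset_succ_of_notMem (heq ▸ hx)]
      exact h.current x
  order x y := by
    have := lastReset_le ρ j x
    have := lastReset_le ρ j y
    have := lastReset_le ρ j' x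
    have := lastReset_le ρ j' y
    have := h.order x y
    have hr : ∀ z, (lastReset ρ (j + 1) z = j + 1 ∧ lastReset ρ (j' + 1) z = j' + 1) ∨
        (lastReset ρ (j + 1) z = lastReset ρ j z ∧ lastReset ρ (j' + 1) z = lastReset ρ j' z) := by
      intro z
      by_cases hz : z ∈ (ρ j).reset
      · exact .inl ⟨lastReset_succ_of_mem hz, lastReset_succ_of_mem (heq ▸ hz)⟩
      · exact .inr ⟨lastReset_succ_of_notMem hz, lastReset_succ_of_notMem (heq ▸ hz)⟩
    have := hr x
    have := hr y
    omega

/-- What the guards and the transitions depend on within a time unit. -/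
abbrev UnitState (D : TimedAutomaton Unit) : Type :=
  D.State × Set D.Clock × Set (D.Clock × D.Clock)

/-- Pigeonhole on the first `B + 1` events of the unit, the last of which is the middle one. -/
theorem exists_similar (hB : Nat.card D.UnitState ≤ B) (n : ℕ) :
    ∃ p p', p < p' ∧ p' ≤ B ∧ Similar B ρ n (n * (2 * B + 1) + p) (n * (2 * B + 1) + p') := by
  have := D.finite_state
  have := D.finite_clock
  let f : Fin (B + 1) → D.UnitState := fun p =>
    ((ρ (n * (2 * B + 1) + p)).src, {x | n * (2 * B + 1) < lastReset ρ (n * (2 * B + 1) + p) x},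
      {x | lastReset ρ (n * (2 * B + 1) + p) x.1 < lastReset ρ (n * (2 * B + 1) + p) x.2})
  have hf : ¬ Function.Injective f := fun hf => by
    have := Nat.card_le_card_of_injective f hf
    rw [Nat.card_fin] at this
    omega
  obtain ⟨p, p', heq, hne⟩ := Function.not_injective_iff.1 hf
  wlog hp : p < p' generalizing p p'
  · exact this p' p heq.symm hne.symm (lt_of_le_of_ne (not_lt.1 hp) hne.symm)
  refine ⟨p, p', hp, Nat.lt_succ_iff.1 p'.2, congrArg Prod.fst heq, fun x => ?_, fun x y => ?_⟩
  · exact Set.ext_iff.1 (congrArg (fun z => z.2.1) heq) x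
  · exact Set.ext_iff.1 (congrArg (fun z => z.2.2) heq) (x, y)

/-- The deterministic automaton never remembers the time of a middle event. -/
theorem not_isMiddle_lastReset (hD : D.IsDeterministic) (hB : Nat.card D.UnitState ≤ B)
    (hρ : D.IsRun (middleWord B false) ρ) (n : ℕ) (x : D.Clock) :
    ¬ IsMiddle B (lastReset ρ (n * (2 * B + 1)) x) := by
  induction n generalizing x with
  | zero =>
    rintro ⟨m, hm⟩
    have := lastReset_le ρ (0 * (2 * B + 1)) x
    omega
  | succ n ih =>
    have hK : (n + 1) * (2 * B + 1) = n * (2 * B + 1) + (2 * B + 1) := Nat.succ_mul _ _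
    rcases le_or_gt (lastReset ρ ((n + 1) * (2 * B + 1)) x) (n * (2 * B + 1)) with h | h
    · rw [lastReset_eq_of_le (by omega) h]
      exact ih x
    · rintro ⟨m, hm⟩
      have hle := lastReset_le ρ ((n + 1) * (2 * B + 1)) x
      have hmn : m = n := by
        rw [hm] at h hle
        rcases lt_trichotomy m n with h1 | h1 | h1
        · have := mul_add_le_mul (K := 2 * B + 1) h1
          omega
        · exact h1
        · have := mul_add_le_mul (K := 2 * B + 1) h1
          omega
      subst hmn
      obtain ⟨hx, hx'⟩ := mem_reset_of_lastReset_eq hm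
      obtain ⟨p, p', hp, hp', hsim⟩ := exists_similar (ρ := ρ) hB m
      -- Similar events take equal transitions and so have similar successors: the similarity shifts
      -- to the end of the unit.
      have key : ∀ i, p' + i ≤ 2 * B →
          Similar B ρ m (m * (2 * B + 1) + p + i) (m * (2 * B + 1) + p' + i) := by
        intro i
        induction i with
        | zero => exact fun _ => hsim
        | succ i ih' =>
          intro hi
          have h1 := ih' (by omega)
          exact h1.succ hρ (by omega) (by omega)
            (h1.eq hD hρ ih (by omega) (by omega) (by omega) (by omega))
      -- Shifting by `B - p` moves `p` to the middle and `p'` to a later event, still in the unit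
      -- since `p' + (B - p) ≤ 2 * B`. That event resets `x` again, so the middle one was not the
      -- last reset.
      have heq := (key (B - p) (by omega)).eq hD hρ ih (by omega) (by omega) (by omega) (by omega)
      rw [show m * (2 * B + 1) + p + (B - p) = m * (2 * B + 1) + B by omega] at heq
      rw [heq] at hx
      exact hx' _ (by omega) (by omega) hx

/-- The run on the first word is also a run on the second one. -/
theorem isRun_middleWord_true (hD : D.IsDeterministic) (hB : Nat.card D.UnitState ≤ B)
    (hρ : D.IsRun (middleWord B false) ρ) : D.IsRun (middleWord B true) ρ where
  mem := hρ.mem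
  start := hρ.start
  step := hρ.step
  letter _ := rfl
  guard j := by
    obtain ⟨n, p, hp, rfl⟩ := exists_eq_mul_add (B := B) j
    have hK : (n + 1) * (2 * B + 1) = n * (2 * B + 1) + (2 * B + 1) := Nat.succ_mul _ _
    refine (guard_sat_iff (n := n) false true ?_ (fun _ _ _ _ => Iff.rfl) _).1 (hρ.guard _)
    intro v
    have hv : relevantPoint ρ (n * (2 * B + 1) + p) v ≤ (n + 1) * (2 * B + 1) := by
      cases v with
      | none => simp only [relevantPoint]; omega
      | some x => exact (lastReset_le _ _ _).trans (by omega)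
    rcases le_or_gt (relevantPoint ρ (n * (2 * B + 1) + p) v) (n * (2 * B + 1)) with h | h
    · refine .inl ⟨h, rfl, ?_⟩
      cases v with
      | none => simp only [relevantPoint] at h; omega
      | some x =>
        simp only [relevantPoint] at h ⊢
        rw [lastReset_eq_of_le (by omega) h]
        exact not_isMiddle_lastReset hD hB hρ n x
    · exact .inr ⟨⟨h, hv⟩, ⟨h, hv⟩⟩

/-- No deterministic timed automaton recognises a language that agrees with the witness language on
the non-Zeno words. -/
theorem IsDeterministic.language_ne {W L : Set (TimedWord Unit)} (hD : D.IsDeterministic)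
    (hW : nonZenoWords Unit ⊆ W)
    (hL : ∀ w ∈ nonZenoWords Unit, w ∈ L ↔ w ∈ unitDistanceLanguage) : D.language W ≠ L := by
  intro h
  have hf : middleWord (Nat.card D.UnitState) false ∈ D.language W :=
    h ▸ (hL _ (not_isZeno false)).2 false_mem_unitDistanceLanguage
  obtain ⟨-, ρ, hρ, hacc⟩ := hf
  have ht : middleWord (Nat.card D.UnitState) true ∈ D.language W :=
    ⟨hW (not_isZeno true), ρ, isRun_middleWord_true hD le_rfl hρ, hacc⟩
  exact true_notMem_unitDistanceLanguage ((hL _ (not_isZeno true)).1 (h ▸ ht))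

end TimedAutomaton

/-! ### Separation of the classes -/

theorem mem_hdCoBuchiLanguages_and_notMem_detParityLanguages
    {W L : Set (TimedWord Unit)} (hW : nonZenoWords Unit ⊆ W)
    (hL : ∀ w ∈ nonZenoWords Unit, w ∈ L ↔ w ∈ unitDistanceLanguage)
    (hlang : chainAutomaton.language W = L) :
    L ∈ hdCoBuchiLanguages W ∧ L ∉ detParityLanguages W :=
  ⟨⟨chainAutomaton, chainAutomaton.isHistoryDeterministic W,
    chainAutomaton.isStateCoBuchi.isCoBuchi, hlang⟩,
    fun ⟨_, hD, _, h⟩ => hD.language_ne hW hL h⟩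

theorem mainTheorem4 :
    -- Timed words are non-Zeno: the witness language is `unitDistanceLanguage`.
    ((∃ T : TimedAutomaton Unit, Nat.card T.Clock = 1 ∧ T.IsStateCoBuchi ∧
        T.IsHistoryDeterministic (nonZenoWords Unit) ∧
        T.language (nonZenoWords Unit) = unitDistanceLanguage) ∧
      (¬ ∃ D : TimedAutomaton Unit, D.IsDeterministic ∧ D.IsParity ∧
        D.language (nonZenoWords Unit) = unitDistanceLanguage)) ∧
    -- Zeno words are allowed: the witness language also contains all Zeno words.
    ((∃ T : TimedAutomaton Unit, Nat.card T.Clock = 1 ∧ T.IsStateCoBuchi ∧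
        T.IsHistoryDeterministic Set.univ ∧
        T.language Set.univ = unitDistanceLanguage ∪ zenoWords Unit) ∧
      (¬ ∃ D : TimedAutomaton Unit, D.IsDeterministic ∧ D.IsParity ∧
        D.language Set.univ = unitDistanceLanguage ∪ zenoWords Unit)) ∧
    -- Comparison of the classes of languages, under both conventions.
    (∀ W : ∀ A : Type, Set (TimedWord A), W = nonZenoWords ∨ W = (fun _ => Set.univ) →
      ¬ hdCoBuchiLanguages (W Unit) ⊆ detParityLanguages (W Unit) ∧
      (∀ A : Type, detCoBuchiLanguages (W A) ⊆ hdCoBuchiLanguages (W A)) ∧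
      detCoBuchiLanguages (W Unit) ⊂ hdCoBuchiLanguages (W Unit) ∧
      (∀ A : Type, detParityLanguages (W A) ⊆ hdParityLanguages (W A)) ∧
      detParityLanguages (W Unit) ⊂ hdParityLanguages (W Unit)) := by
  have hL : ∀ w ∈ nonZenoWords Unit,
      w ∈ unitDistanceLanguage ∪ zenoWords Unit ↔ w ∈ unitDistanceLanguage :=
    fun w hw => ⟨fun h => h.resolve_right hw, Or.inl⟩
  refine ⟨⟨⟨chainAutomaton, chainAutomaton.card_clock, chainAutomaton.isStateCoBuchi,
      chainAutomaton.isHistoryDeterministic _, chainAutomaton.language_nonZenoWords⟩,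
      fun ⟨_, hD, _, h⟩ => hD.language_ne subset_rfl (fun _ _ => Iff.rfl) h⟩,
    ⟨⟨chainAutomaton, chainAutomaton.card_clock, chainAutomaton.isStateCoBuchi,
      chainAutomaton.isHistoryDeterministic _, chainAutomaton.language_univ⟩,
      fun ⟨_, hD, _, h⟩ => hD.language_ne (Set.subset_univ _) hL h⟩, fun W hW => ?_⟩
  obtain ⟨L, hmem, hnot⟩ : ∃ L,
      L ∈ hdCoBuchiLanguages (W Unit) ∧ L ∉ detParityLanguages (W Unit) := by
    rcases hW with rfl | rfl
    · exact ⟨_, mem_hdCoBuchiLanguages_and_notMem_detParityLanguages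
        subset_rfl (fun _ _ => Iff.rfl)
        chainAutomaton.language_nonZenoWords⟩
    · exact ⟨_, mem_hdCoBuchiLanguages_and_notMem_detParityLanguages
        (Set.subset_univ _) hL
        chainAutomaton.language_univ⟩
  exact ⟨fun h => hnot (h hmem),
    fun A => detCoBuchiLanguages_subset_hdCoBuchiLanguages (W A),
    ⟨detCoBuchiLanguages_subset_hdCoBuchiLanguages _,
      fun h => hnot (detCoBuchiLanguages_subset_detParityLanguages _ (h hmem))⟩,
    fun A => detParityLanguages_subset_hdParityLanguages (W A),
    ⟨detParityLanguages_subset_hdParityLanguages _,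
      fun h => hnot (h (hdCoBuchiLanguages_subset_hdParityLanguages _ hmem))⟩⟩
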